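/- Let $d\ge 2$ and $k\ge 1$ be integers. An $m$-dimensional polytope in $\mathbb{R}^d$ is a (not necessarily convex) finite union of $m$-simplices lying in one $m$-dimensional affine subspace, with connected relative interior. A polytopal partition $\mathcal{T}_h$ of a bounded connected open set $\Omega\subset\mathbb{R}^d$ is a finite family of $d$-dimensional polytopes $T$ with pairwise disjoint interiors and union $\overline\Omega$, where each boundary $\partial T$ is the union of finitely many flat sides $e$ (edges if $d=2$, faces if $d=3$), which are $(d-1)$-dimensional polytopes, such that two different sides (of the same or of different elements) overlap in a set of zero $(d-1)$-dimensional measure. Write $h_T$ and $h_e$ for the diameters of $T$ and $e$, and $|T|$ and $|e|$ for their $d$- and $(d-1)$-dimensional measures. The partition is shape regular with parameters $\varrho_v,\varrho_e,\kappa,\sigma^*>0$, $\theta_0\in[0,\pi/2)$, $N\in\mathbb{N}$ if for every $T\in\mathcal{T}_h$ and every side $e$ of $T$: (1) $\varrho_v h_T^d\le |T|$ and $\varrho_e h_e^{d-1}\le |e|$; (2) $\kappa h_T\le h_e$; (3) there is a point $A_e\in T$ such that the pyramid $\bigcup_{x\in e}[x,A_e]$ with base $e$ and apex $A_e$ is contained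 in $T$, has height at least $\sigma^* h_T$, and the angle between $x-A_e$ and the outward unit normal of $e$ is at most $\theta_0$ for all $x\in e$; (4) at most $N$ sides of $T$ are non-convex (no condition if $d=2$ or if all sides are convex). Let $\mathsf{RM}=\{x\mapsto a+\eta x:\ a\in\mathbb{R}^d,\ \eta\in\mathbb{R}^{d\times d},\ \eta^T=-\eta\}$, let $P_m$ be the space of polynomials of total degree at most $m$, and for each side $e$ let $Q_b$ be the $L^2(e)$-orthogonal projection onto the space $V_{k-1}(e)$ of restrictions to $e$ of the fields in $[P_{k-1}]^d+\mathsf{RM}$. Let $\varepsilon(v)=\frac12(\nabla v+\nabla v^T)$, $\|\varepsilon(v)\|_T^2=\int_T\sum_{i,j}\varepsilon_{ij}(v)^2\,dx$, and $\|v-Q_bv\|_{\partial T}^2=\sum_{e\subset\partial T}\int_e|v-Q_bv|^2\,ds$, the sum being over the sides $e$ of $T$. Then there is a constant $C>0$, depending only on $d$, $k$ and the parameters $\varrho_v,\varrho_e,\kappa,\sigma^*,\theta_0,N$, such that for every bounded connected open set $\Omega$, every polytopal partition $\mathcal{T}_h$ of $\Omega$ that is shape regular with these parameters, every $T\in\mathcal{T}_h$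 and every $v_0\in[P_k(T)]^d$, $$\|v_0-Q_bv_0\|_{\partial T}^2\le C\,h_T\,\|\varepsilon(v_0)\|_T^2 .$$ -/

import Mathlib

open MeasureTheory
open scoped MeasureTheory

noncomputable section

namespace WG

/-- Euclidean space `ℝ^d`. -/
abbrev E (d : ℕ) : Type := EuclideanSpace ℝ (Fin d)

/-! ### Polynomial vector fields, rigid motions, strain -/

/-- `[P_m]^d`: vector fields all of whose components are polynomials of total degree at most `m`. -/
def polyField (d m : ℕ) : Submodule ℝ (E d → E d) where
  carrier := {v | ∀ i, ∃ p : MvPolynomial (Fin d) ℝ, p.totalDegree ≤ m ∧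
    ∀ x, v x i = MvPolynomial.eval (fun j => x j) p}
  add_mem' := by
    intro v w hv hw i
    obtain ⟨p, hp, hpv⟩ := hv i
    obtain ⟨q, hq, hqw⟩ := hw i
    exact ⟨p + q, (MvPolynomial.totalDegree_add p q).trans (max_le hp hq),
      fun x => by simp [hpv, hqw]⟩
  zero_mem' := fun i => ⟨0, by simp, fun x => by simp⟩
  smul_mem' := by
    intro c v hv i
    obtain ⟨p, hp, hpv⟩ := hv i
    exact ⟨c • p, (MvPolynomial.totalDegree_smul_le c p).trans hp, fun x => by simp [hpv]⟩

/-- `RM`: the rigid motions `x ↦ a + η x` with `η` a skew-symmetric matrix. -/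
def rigidMotion (d : ℕ) : Submodule ℝ (E d → E d) where
  carrier := {v | ∃ (a : E d) (η : Matrix (Fin d) (Fin d) ℝ), η.transpose = -η ∧
    ∀ x i, v x i = a i + ∑ j, η i j * x j}
  add_mem' := by
    rintro v w ⟨a, η, hη, hv⟩ ⟨b, θ, hθ, hw⟩
    refine ⟨a + b, η + θ, ?_, fun x i => ?_⟩
    · rw [Matrix.transpose_add, hη, hθ, neg_add]
    · simp only [Pi.add_apply, PiLp.add_apply, hv, hw, Matrix.add_apply, add_mul,
        Finset.sum_add_distrib]
      ring
  zero_mem' := ⟨0, 0, by simp, fun x i => by simp⟩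
  smul_mem' := by
    rintro c v ⟨a, η, hη, hv⟩
    refine ⟨c • a, c • η, ?_, fun x i => ?_⟩
    · rw [Matrix.transpose_smul, hη, smul_neg]
    · simp only [Pi.smul_apply, PiLp.smul_apply, hv, Matrix.smul_apply, smul_eq_mul, mul_add,
        Finset.mul_sum, mul_assoc]

/-- The strain tensor `ε(v) = (∇v + ∇vᵀ) / 2`. -/
def strain {d : ℕ} (v : E d → E d) (x : E d) (i j : Fin d) : ℝ :=
  (fderiv ℝ v x (EuclideanSpace.single j 1) i + fderiv ℝ v x (EuclideanSpace.single i 1) j) / 2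

/-- `‖ε(v)‖²_T`. -/
def strainNormSq {d : ℕ} (v : E d → E d) (T : Set (E d)) : ℝ :=
  ∫ x in T, ∑ i, ∑ j, strain v x i j ^ 2

/-! ### The projection `Q_b` -/

/-- The `(d-1)`-dimensional surface measure on a flat side `e`. -/
def sideMeasure {d : ℕ} (e : Set (E d)) : Measure (E d) := μHE[d - 1].restrict e

/-- `[P_{k-1}]^d + RM`. -/
def sideField (d k : ℕ) : Submodule ℝ (E d → E d) := polyField d (k - 1) ⊔ rigidMotion d

/-- `V_{k-1}(e)`: the space of traces on `e` of the fields in `[P_{k-1}]^d + RM`, as a subspace of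
`[L²(e)]^d`. -/
def sideSpace {d : ℕ} (k : ℕ) (e : Set (E d)) : Submodule ℝ (Lp (E d) 2 (sideMeasure e)) where
  carrier := {f | ∃ p ∈ sideField d k, f =ᵐ[sideMeasure e] p}
  add_mem' := by
    rintro f g ⟨p, hp, hf⟩ ⟨q, hq, hg⟩
    exact ⟨p + q, add_mem hp hq, (Lp.coeFn_add f g).trans (hf.add hg)⟩
  zero_mem' := ⟨0, zero_mem _, Lp.coeFn_zero _ _ _⟩
  smul_mem' := by
    rintro c f ⟨p, hp, hf⟩
    exact ⟨c • p, Submodule.smul_mem _ c hp, (Lp.coeFn_smul c f).trans (hf.const_smul c)⟩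

instance polyField_finite (d m : ℕ) : FiniteDimensional ℝ (polyField d m) := by
  let L : (Fin d → MvPolynomial.restrictTotalDegree (Fin d) ℝ m) →ₗ[ℝ] (E d → E d) :=
    { toFun := fun p x => WithLp.toLp 2 fun i =>
        MvPolynomial.eval (fun j => x j) (p i : MvPolynomial (Fin d) ℝ)
      map_add' := fun p q => by ext x i; simp
      map_smul' := fun c p => by ext x i; simp }
  have h : polyField d m ≤ LinearMap.range L := by
    intro v hv
    choose p hp hpv using hv
    refine ⟨fun i => ⟨p i, (MvPolynomial.mem_restrictTotalDegree _ _ _).2 (hp i)⟩, ?_⟩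
    ext x i
    simp [L, hpv]
  exact Submodule.finiteDimensional_of_le h

theorem rigidMotion_le (d : ℕ) : rigidMotion d ≤ polyField d 1 := by
  rintro v ⟨a, η, -, hv⟩ i
  refine ⟨MvPolynomial.C (a i) + ∑ j, MvPolynomial.C (η i j) * MvPolynomial.X j, ?_,
    fun x => by simp [hv]⟩
  refine (MvPolynomial.totalDegree_add _ _).trans (max_le (by simp) ?_)
  refine (MvPolynomial.totalDegree_finsetSum _ _).trans (Finset.sup_le fun j _ => ?_)
  refine (MvPolynomial.totalDegree_mul _ _).trans ?_
  simp

instance sideField_finite (d k : ℕ) : FiniteDimensional ℝ (sideField d k) := by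
  have : FiniteDimensional ℝ (rigidMotion d) :=
    Submodule.finiteDimensional_of_le (rigidMotion_le d)
  unfold sideField
  infer_instance

instance sideSpace_finite {d : ℕ} (k : ℕ) (e : Set (E d)) :
    FiniteDimensional ℝ (sideSpace k e) := by
  let S : Submodule ℝ (sideField d k) :=
    { carrier := {p | MemLp (p : E d → E d) 2 (sideMeasure e)}
      add_mem' := fun hp hq => MemLp.add hp hq
      zero_mem' := MemLp.zero'
      smul_mem' := fun c _ hp => MemLp.const_smul hp c }
  let L : S →ₗ[ℝ] Lp (E d) 2 (sideMeasure e) :=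
    { toFun := fun p => MemLp.toLp (p.1 : E d → E d) p.2
      map_add' := fun _ _ => rfl
      map_smul' := fun _ _ => rfl }
  have h : sideSpace k e ≤ LinearMap.range L := by
    rintro f ⟨p, hp, hf⟩
    have hm : MemLp p 2 (sideMeasure e) := (memLp_congr_ae hf).1 (Lp.memLp f)
    refine ⟨⟨⟨p, hp⟩, hm⟩, ?_⟩
    apply Lp.ext
    exact (MemLp.coeFn_toLp hm).trans hf.symm
  exact Submodule.finiteDimensional_of_le h

open Classical in
/-- `Q_b v` on the side `e`: the `L²(e)`-orthogonal projection of `v|_e` onto `V_{k-1}(e)` (defined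
up to null sets of the surface measure; set to zero if `v|_e` is not square integrable, which does
not happen for polynomial fields on bounded flat sides, see `memLp_side`). -/
def Qb {d : ℕ} (k : ℕ) (e : Set (E d)) (v : E d → E d) : E d → E d :=
  if h : MemLp v 2 (sideMeasure e) then
    ((sideSpace k e).starProjection (MemLp.toLp v h) : Lp (E d) 2 (sideMeasure e))
  else 0

/-- `‖v - Q_b v‖²_e` on one side `e`. -/
def sideErrorSq {d : ℕ} (k : ℕ) (v : E d → E d) (e : Set (E d)) : ℝ :=
  ∫ x, ‖v x - Qb k e v x‖ ^ 2 ∂(sideMeasure e)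

/-! ### Polytopal partitions -/

/-- `P` is a (not necessarily convex) closed `m`-dimensional polytope in `ℝ^d`: it lies in an
`m`-dimensional affine subspace, it is a finite union of `m`-simplices, and its relative interior
is connected. -/
def IsPolytope {d : ℕ} (m : ℕ) (P : Set (E d)) : Prop :=
  (∃ A : AffineSubspace ℝ (E d), Module.finrank ℝ A.direction = m ∧ P ⊆ A) ∧
  (∃ S : Finset (Finset (E d)),
    (∀ s ∈ S, s.card = m + 1 ∧ AffineIndependent ℝ ((↑) : s → E d)) ∧
    P = ⋃ s ∈ S, convexHull ℝ (s : Set (E d))) ∧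
  IsConnected (intrinsicInterior ℝ P)

/-- A finite partition of `Ω` into closed polytopes (polygons if `d = 2`, polyhedra if `d = 3`),
with the flat sides (edges if `d = 2`, faces if `d = 3`) of its elements. Two different sides, of
one element or of two, overlap in a null set only, so a side that two elements share is the same
for both; several sides of an element may lie in one hyperplane (hanging nodes). -/
structure PolytopalPartition (d : ℕ) (Ω : Set (E d)) where
  elements : Finset (Set (E d))
  sides : Set (E d) → Finset (Set (E d))
  isPolytope : ∀ T ∈ elements, IsPolytope d T
  cover : ⋃ T ∈ elements, T = closure Ω
  disjoint : ∀ T ∈ elements, ∀ T' ∈ elements, T ≠ T' → Disjoint (interior T) (interior T')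
  isPolytope_side : ∀ T ∈ elements, ∀ e ∈ sides T, IsPolytope (d - 1) e
  boundary : ∀ T ∈ elements, ⋃ e ∈ sides T, e = frontier T
  sides_overlap : ∀ T ∈ elements, ∀ T' ∈ elements, ∀ e ∈ sides T, ∀ e' ∈ sides T', e ≠ e' →
    μHE[d - 1] (e ∩ e') = 0

/-- `‖v - Q_b v‖²_{∂T}`, where `Q_b` acts on each side of `T` separately. -/
def PolytopalPartition.boundaryErrorSq {d : ℕ} {Ω : Set (E d)} (𝒯 : PolytopalPartition d Ω)
    (k : ℕ) (v : E d → E d) (T : Set (E d)) : ℝ :=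
  ∑ e ∈ 𝒯.sides T, sideErrorSq k v e

/-- Shape regularity parameters. -/
structure ShapeParams where
  ρv : ℝ
  ρe : ℝ
  κ : ℝ
  σ : ℝ
  θ : ℝ
  N : ℕ
  ρv_pos : 0 < ρv
  ρe_pos : 0 < ρe
  κ_pos : 0 < κ
  σ_pos : 0 < σ
  θ_nonneg : 0 ≤ θ
  θ_lt : θ < Real.pi / 2

/-- The side `e` is the base of a pyramid contained in `T` whose height is at least `σ h_T`, such
that the angle between `x - A` (`A` the apex, `x ∈ e`) and the normal `n` to `e` pointing out of
the pyramid is at most `θ`. -/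
def HasPyramid {d : ℕ} (T e : Set (E d)) (σ θ : ℝ) : Prop :=
  ∃ (A n : E d) (c : ℝ), A ∈ T ∧ ‖n‖ = 1 ∧ (∀ x ∈ e, inner ℝ n x = c) ∧
    (⋃ x ∈ e, segment ℝ x A) ⊆ T ∧
    σ * Metric.diam T ≤ c - inner ℝ n A ∧
    ∀ x ∈ e, InnerProductGeometry.angle (x - A) n ≤ θ

/-- Shape regularity of a polytopal partition with given parameters. -/
structure PolytopalPartition.ShapeRegular {d : ℕ} {Ω : Set (E d)} (𝒯 : PolytopalPartition d Ω)
    (s : ShapeParams) : Prop where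
  volume_ge : ∀ T ∈ 𝒯.elements, s.ρv * Metric.diam T ^ d ≤ volume.real T
  area_ge : ∀ T ∈ 𝒯.elements, ∀ e ∈ 𝒯.sides T,
    s.ρe * Metric.diam e ^ (d - 1) ≤ (μHE[d - 1]).real e
  diam_side_ge : ∀ T ∈ 𝒯.elements, ∀ e ∈ 𝒯.sides T, s.κ * Metric.diam T ≤ Metric.diam e
  pyramid : ∀ T ∈ 𝒯.elements, ∀ e ∈ 𝒯.sides T, HasPyramid T e s.σ s.θ
  /-- At most `N` sides of an element are non-convex (this is empty for `d = 2`). -/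
  nonconvex_sides : ∀ T ∈ 𝒯.elements, {e | e ∈ 𝒯.sides T ∧ ¬ Convex ℝ e}.ncard ≤ s.N

/-! ### `Q_b v` is never the default value on a side -/

theorem IsPolytope.isCompact {d m : ℕ} {P : Set (E d)} (h : IsPolytope m P) : IsCompact P := by
  obtain ⟨-, ⟨S, -, rfl⟩, -⟩ := h
  exact S.isCompact_biUnion fun s _ => Set.Finite.isCompact_convexHull (𝕜 := ℝ) s.finite_toSet

theorem IsPolytope.measure_lt_top {d m : ℕ} {P : Set (E d)} (h : IsPolytope m P) :
    μHE[m] P < ⊤ := by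
  have hc := h.isCompact
  obtain ⟨⟨A, hA, hP⟩, -, hne⟩ := h
  obtain ⟨x, hx⟩ := hne.nonempty
  have hxP : x ∈ P := intrinsicInterior_subset hx
  have : Nonempty A := ⟨⟨x, hP hxP⟩⟩
  have himg : P = ((↑) : A → E d) '' (((↑) : A → E d) ⁻¹' P) := by
    rw [Set.image_preimage_eq_inter_range, Subtype.range_coe]
    exact (Set.inter_eq_left.2 hP).symm
  have hcA : IsCompact (((↑) : A → E d) ⁻¹' P) :=
    (AffineSubspace.closed_of_finiteDimensional A).isClosedEmbedding_subtypeVal.isCompact_preimage hc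
  let p : A := ⟨x, hP hxP⟩
  rw [himg, AffineSubspace.euclideanHausdorffMeasure_coe_image, ← hA,
    EuclideanGeometry.euclideanHausdorffMeasure_eq p,
    Measure.map_apply (IsometryEquiv.vaddConst p).continuous.measurable hcA.measurableSet]
  exact ((IsometryEquiv.vaddConst p).toHomeomorph.isCompact_preimage.2 hcA).measure_lt_top

theorem polyField_continuous {d k : ℕ} {v : E d → E d} (hv : v ∈ polyField d k) :
    Continuous v := by
  have h : Continuous fun x => (v x).ofLp := by
    refine continuous_pi fun i => ?_
    obtain ⟨p, -, hp⟩ := hv i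
    simp_rw [hp]
    exact (MvPolynomial.continuous_eval p).comp (PiLp.continuous_ofLp 2 _)
  exact (PiLp.continuous_toLp 2 _).comp h

theorem memLp_side {d k : ℕ} {e : Set (E d)} (h : IsPolytope (d - 1) e) {v : E d → E d}
    (hv : v ∈ polyField d k) : MemLp v 2 (sideMeasure e) := by
  have : IsFiniteMeasure (sideMeasure e) :=
    ⟨by rw [sideMeasure, Measure.restrict_apply_univ]; exact h.measure_lt_top⟩
  have hcont := polyField_continuous hv
  obtain ⟨C, hC⟩ := h.isCompact.exists_bound_of_continuousOn hcont.continuousOn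
  refine MemLp.of_bound hcont.aestronglyMeasurable C ?_
  exact (ae_restrict_iff' h.isCompact.measurableSet).2 (Filter.Eventually.of_forall hC)

end WG

end

/-!
Scaling reduces the estimate to elements of diameter `1`. On a side, `Q_b v` is the best
approximation of `v` in a space containing the rigid motions, so the error is at most the distance
of `v` to a single rigid motion, and Korn's inequality for polynomial fields bounds that distance.
The constant in Korn's inequality depends on the element only through a lower bound `ρ` for its
volume: modulo rigid motions the strain is injective on polynomial fields, so the zero set of the
analytic function `|ε(v)|²` is null for every `v` on the unit sphere of the quotient, and as this
sphere is compact there is a single `δ > 0` for which all of the sets `{|ε(v)|² ≤ δ}` have measure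
less than `ρ / 2`.

What remains is to bound the number of sides. All but `N` of them are convex, and the pyramid over
a convex side contains a simplex whose determinant is bounded below. These simplices range over a
compact set, and two convex sides whose simplices are close to each other would overlap in positive
`(d - 1)`-dimensional measure, so a finite cover of that compact set bounds the number of convex
sides.
-/

open Set Filter Topology

namespace WG

section Sublevel

variable {X : Type*} [TopologicalSpace X] [MeasurableSpace X] {μ : Measure X} [μ.OuterRegular]
  {B : Set X} {c : ENNReal}

theorem eventually_measure_sublevel_lt {Y : Type*} [TopologicalSpace Y] {F : Y → X → ℝ}
    (hF : Continuous (Function.uncurry F)) (hB : IsCompact B) {y₀ : Y}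
    (h : μ {x ∈ B | F y₀ x ≤ 0} < c) : ∀ᶠ y in 𝓝 y₀, μ {x ∈ B | F y x ≤ 0} < c := by
  obtain ⟨U, hKU, hU, hUc⟩ := exists_isOpen_lt_of_lt _ _ h
  have hmem : ∀ᶠ y in 𝓝 y₀, ∀ x ∈ B, F y x ≤ 0 → x ∈ U := by
    refine hB.eventually_forall_of_forall_eventually fun x hx => ?_
    rcases le_or_gt (F y₀ x) 0 with hFx | hFx
    · have hxU : ∀ᶠ x' in 𝓝 x, x' ∈ U := hU.mem_nhds (hKU ⟨hx, hFx⟩)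
      filter_upwards [continuous_snd.continuousAt.eventually hxU] with z hz _ using hz
    · filter_upwards [hF.continuousAt.eventually_const_lt hFx] with z hz hz'
      exact absurd hz' hz.not_ge
  filter_upwards [hmem] with y hy
  exact (measure_mono fun x hx => hy x hx.1 hx.2).trans_lt hUc

theorem exists_forall_measure_sublevel_lt {V : Type*} [TopologicalSpace V] {F : V → X → ℝ}
    (hF : Continuous (Function.uncurry F)) (hB : IsCompact B) {S : Set V} (hS : IsCompact S)
    (h : ∀ v ∈ S, μ {x ∈ B | F v x ≤ 0} < c) :
    ∃ δ : ℝ, 0 < δ ∧ ∀ v ∈ S, μ {x ∈ B | F v x ≤ δ} < c := by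
  have hδ : ∀ᶠ δ : ℝ in 𝓝 0, ∀ v ∈ S, μ {x ∈ B | F v x - δ ≤ 0} < c :=
    hS.eventually_forall_of_forall_eventually fun v hv =>
      eventually_measure_sublevel_lt (F := fun z : ℝ × V => fun x => F z.2 x - z.1)
        ((hF.comp (by fun_prop : Continuous fun q : (ℝ × V) × X => (q.1.2, q.2))).sub
          (by fun_prop)) hB (by simpa using h v hv)
  obtain ⟨δ, hδS, hδ0⟩ := ((hδ.filter_mono nhdsWithin_le_nhds).and
    (self_mem_nhdsWithin (s := Ioi (0 : ℝ)))).exists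
  exact ⟨δ, hδ0, by simpa only [sub_nonpos] using hδS⟩

theorem exists_forall_measure_sublevel_mul_norm_pow_lt {W : Type*} [NormedAddCommGroup W]
    [NormedSpace ℝ W] [FiniteDimensional ℝ W] {F : W → X → ℝ}
    (hF : Continuous (Function.uncurry F)) {p : ℕ}
    (hhom : ∀ (t : ℝ) w x, F (t • w) x = |t| ^ p * F w x) (hB : IsCompact B)
    (h : ∀ w ≠ 0, μ {x ∈ B | F w x ≤ 0} < c) :
    ∃ δ : ℝ, 0 < δ ∧ ∀ w ≠ 0, μ {x ∈ B | F w x ≤ δ * ‖w‖ ^ p} < c := by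
  obtain ⟨δ, hδ, hδS⟩ := exists_forall_measure_sublevel_lt hF hB (isCompact_sphere (0 : W) 1)
    fun w hw => h w (ne_zero_of_mem_unit_sphere ⟨w, hw⟩)
  refine ⟨δ, hδ, fun w hw => (measure_mono ?_).trans_lt
    (hδS (‖w‖⁻¹ • w) (by simp [norm_smul, hw]))⟩
  rintro x ⟨hxB, hx⟩
  refine ⟨hxB, ?_⟩
  rw [hhom, abs_of_nonneg (by positivity), inv_pow, inv_mul_le_iff₀ (by positivity), mul_comm]
  exact hx

end Sublevel

/-! ### Analytic functions -/

section Analytic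

variable {V : Type*} [NormedAddCommGroup V] [NormedSpace ℝ V] [MeasurableSpace V]
  [BorelSpace V] [FiniteDimensional ℝ V] (μ : Measure V) [μ.IsAddHaarMeasure]

theorem measure_eq_zero_of_forall_line_null {Z : Set V} (hZ : IsClosed Z) (y : V)
    (h : ∀ x, volume {t : ℝ | y + t • x ∈ Z} = 0) : μ Z = 0 := by
  have hS : MeasurableSet {q : ℝ × V | y + q.1 • q.2 ∈ Z} :=
    (hZ.preimage (f := fun q : ℝ × V => y + q.1 • q.2) (by fun_prop)).measurableSet
  have h0 : ((volume : Measure ℝ).prod μ) {q : ℝ × V | y + q.1 • q.2 ∈ Z} = 0 := by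
    rw [Measure.prod_apply_symm hS]
    simp only [lintegral_eq_zero_iff (measurable_measure_prodMk_right hS)]
    exact Eventually.of_forall h
  rw [Measure.measure_prod_null hS] at h0
  obtain ⟨t, ht, ht0⟩ : ∃ t : ℝ, μ {x : V | y + t • x ∈ Z} = 0 ∧ t ≠ 0 :=
    (h0.and (Measure.ae_ne volume 0)).exists
  have hpre : {x : V | y + t • x ∈ Z} = (fun x => t • x) ⁻¹' ((fun x => y + x) ⁻¹' Z) := rfl
  rw [hpre, Measure.addHaar_preimage_smul _ ht0, measure_preimage_add] at ht
  simpa [ht0] using ht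

theorem measure_zeros_eq_zero_of_analyticOnNhd {f : V → ℝ} (hf : AnalyticOnNhd ℝ f univ)
    (hne : f ≠ 0) : μ {x | f x = 0} = 0 := by
  obtain ⟨y, hy⟩ := Function.ne_iff.1 hne
  refine measure_eq_zero_of_forall_line_null μ
    (isClosed_eq hf.continuous continuous_const) y fun x => ?_
  have hline : AnalyticOnNhd ℝ (fun t : ℝ => f (y + t • x)) univ := fun t _ =>
    (hf _ (mem_univ _)).comp (by fun_prop : AnalyticAt ℝ (fun t : ℝ => y + t • x) t)
  have hdisc : {t : ℝ | f (y + t • x) = 0}ᶜ ∈ codiscrete ℝ :=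
    hline.preimage_zero_mem_codiscrete (x := 0) (by simpa using hy)
  have hae : {t : ℝ | f (y + t • x) = 0}ᶜ ∈ ae (volume : Measure ℝ) := by
    simpa using ae_restrict_le_codiscreteWithin (μ := volume) MeasurableSet.univ hdisc
  simpa [mem_ae_iff] using hae

end Analytic

section Polynomial

variable {d k : ℕ} {v : E d → E d}

theorem analyticOnNhd_of_mem_polyField (hv : v ∈ polyField d k) : AnalyticOnNhd ℝ v univ := by
  let φ := EuclideanSpace.equiv (Fin d) ℝ
  have hpi : AnalyticOnNhd ℝ (fun x i => φ (v x) i) univ := AnalyticOnNhd.pi fun i => by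
    obtain ⟨p, -, hp⟩ := hv i
    exact (AnalyticOnNhd.eval_continuousLinearMap (φ : E d →L[ℝ] Fin d → ℝ) p).congr isOpen_univ
      fun x _ => (hp x).symm
  exact φ.symm.toContinuousLinearMap.comp_analyticOnNhd hpi

theorem differentiable_of_mem_polyField (hv : v ∈ polyField d k) : Differentiable ℝ v := fun x =>
  (analyticOnNhd_of_mem_polyField hv x trivial).differentiableAt

end Polynomial

/-! ### Fields with vanishing strain -/

section Strain

theorem fderiv_eq_of_inner_fderiv_self_eq_zero {V : Type*} [NormedAddCommGroup V]
    [InnerProductSpace ℝ V] {v : V → V} (hv : ContDiff ℝ 2 v)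
    (h : ∀ x a, inner ℝ (fderiv ℝ v x a) a = 0) (x y : V) : fderiv ℝ v x = fderiv ℝ v y := by
  have hD : Differentiable ℝ (fderiv ℝ v) :=
    (hv.fderiv_right (m := 1) (by norm_num)).differentiable one_ne_zero
  refine is_const_of_fderiv_eq_zero hD (fun z => ?_) x y
  set D := fderiv ℝ (fderiv ℝ v) z
  have symm (a b) : D a b = D b a := hv.contDiffAt.isSymmSndFDerivAt (by simp) a b
  have inner_self (a b) : inner ℝ (D a b) b = 0 := by
    have hderiv := ((hD z).hasFDerivAt.clm_apply (hasFDerivAt_const b z)).inner ℝ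
      (hasFDerivAt_const b z)
    simpa [D] using congrArg (· a) (hderiv.unique
      ((hasFDerivAt_const (0 : ℝ) z).congr_of_eventuallyEq (.of_forall fun w => h w b)))
  have skew (a b c) : inner ℝ (D a b) c = -inner ℝ (D a c) b := by
    have := inner_self a (b + c)
    simp only [map_add, inner_add_left, inner_add_right, inner_self] at this
    linarith
  ext a b
  refine ext_inner_right ℝ fun c => ?_
  -- A trilinear form symmetric in two slots and skew in two slots vanishes.
  have : inner ℝ (D a b) c = -inner ℝ (D a b) c :=
    calc inner ℝ (D a b) c = -inner ℝ (D c a) b := by rw [skew, symm]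
      _ = inner ℝ (D b c) a := by rw [skew, symm, neg_neg]
      _ = -inner ℝ (D a b) c := by rw [skew, symm]
  simpa using self_eq_neg.1 this

variable {d : ℕ} {v : E d → E d}

theorem clm_apply_eq_sum (A : E d →L[ℝ] E d) (x : E d) (i : Fin d) :
    A x i = ∑ j, A (EuclideanSpace.single j 1) i * x j := by
  conv_lhs => rw [← (EuclideanSpace.basisFun (Fin d) ℝ).sum_repr x]
  simp [mul_comm]

theorem inner_fderiv_self_eq_sum_strain (v : E d → E d) (x a : E d) :
    inner ℝ (fderiv ℝ v x a) a = ∑ i, ∑ j, strain v x i j * (a i * a j) := by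
  have hsymm : ∑ i, ∑ j, fderiv ℝ v x (EuclideanSpace.single j 1) i * (a i * a j) =
      ∑ i, ∑ j, fderiv ℝ v x (EuclideanSpace.single i 1) j * (a i * a j) := by
    rw [Finset.sum_comm]
    simp only [mul_comm]
  calc inner ℝ (fderiv ℝ v x a) a
      = ∑ i, ∑ j, fderiv ℝ v x (EuclideanSpace.single j 1) i * (a i * a j) := by
        simp only [PiLp.inner_apply, clm_apply_eq_sum _ a, RCLike.inner_apply, conj_trivial,
          Finset.mul_sum]
        exact Finset.sum_congr rfl fun i _ => Finset.sum_congr rfl fun j _ => by ring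
    _ = ∑ i, ∑ j, strain v x i j * (a i * a j) := by
        simp only [strain, div_mul_eq_mul_div, add_mul, ← Finset.sum_div, Finset.sum_add_distrib,
          ← hsymm, add_self_div_two]

theorem mem_rigidMotion_of_strain_eq_zero (hv : ContDiff ℝ 2 v) (h : strain v = 0) :
    v ∈ rigidMotion d := by
  have hfderiv := fderiv_eq_of_inner_fderiv_self_eq_zero hv fun x a => by
    simp [inner_fderiv_self_eq_sum_strain, h]
  have hdiff : Differentiable ℝ v := hv.differentiable two_ne_zero
  have haffine (x) : v x - fderiv ℝ v 0 x = v 0 := by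
    have := is_const_of_fderiv_eq_zero (hdiff.sub (fderiv ℝ v 0).differentiable)
      (fun y => by simp [fderiv_sub (hdiff y) (fderiv ℝ v 0).differentiableAt, hfderiv y 0]) x 0
    simpa using this
  refine ⟨v 0, .of fun i j => fderiv ℝ v 0 (EuclideanSpace.single j 1) i, ?_, fun x i => ?_⟩
  · ext i j
    have : strain v 0 i j = 0 := by rw [h]; rfl
    simp only [strain] at this
    simp only [Matrix.transpose_apply, Matrix.neg_apply, Matrix.of_apply]
    linarith
  · conv_lhs => rw [← sub_add_cancel (v x) (fderiv ℝ v 0 x), haffine, PiLp.add_apply,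
      clm_apply_eq_sum]
    rfl

end Strain

section FiniteDimensionalFamilies

theorem exists_linearMap_parametrizing_range {V M : Type*} [AddCommGroup V]
    [Module ℝ V] [FiniteDimensional ℝ V] [AddCommGroup M] [Module ℝ M] (f : V →ₗ[ℝ] M) :
    ∃ (n : ℕ) (L : EuclideanSpace ℝ (Fin n) →ₗ[ℝ] V),
      (∀ a, f (L a) = 0 → a = 0) ∧ ∀ v, ∃ a, f (L a) = f v := by
  obtain ⟨s, hs⟩ := f.rangeRestrict.exists_rightInverse_of_surjective f.range_rangeRestrict
  have hfs (y : f.range) : f (s y) = y := congrArg Subtype.val (LinearMap.congr_fun hs y)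
  let e := (Module.finBasis ℝ f.range).equivFun ≪≫ₗ (WithLp.linearEquiv 2 ℝ _).symm
  refine ⟨_, s ∘ₗ e.symm, fun a ha => ?_, fun v => ⟨e (f.rangeRestrict v), ?_⟩⟩
  · simpa [hfs] using ha
  · simp [hfs]

variable {X W Z : Type*} [TopologicalSpace X] [NormedAddCommGroup W] [NormedSpace ℝ W]
  [FiniteDimensional ℝ W] [NormedAddCommGroup Z] [NormedSpace ℝ Z] {L : W →ₗ[ℝ] X → Z}

theorem continuous_uncurry_of_forall_continuous (hL : ∀ w, Continuous (L w)) :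
    Continuous (Function.uncurry fun w => L w) := by
  let b := Module.finBasis ℝ W
  have hsum (q : W × X) : L q.1 q.2 = ∑ i, b.equivFunL q.1 i • L (b i) q.2 := by
    conv_lhs => rw [← b.sum_equivFun q.1, map_sum, Finset.sum_apply]
    simp only [map_smul, Pi.smul_apply, Module.Basis.equivFunL_apply, Module.Basis.equivFun_apply]
  simp only [Function.uncurry_def, hsum]
  exact continuous_finsetSum _ fun i _ =>
    (((continuous_apply i).comp b.equivFunL.continuous).comp continuous_fst).smul
      ((hL _).comp continuous_snd)

theorem exists_forall_norm_le_mul_norm (hL : ∀ w, Continuous (L w)) {B : Set X}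
    (hB : IsCompact B) : ∃ M : ℝ, ∀ w, ∀ x ∈ B, ‖L w x‖ ≤ M * ‖w‖ := by
  obtain ⟨M, hM⟩ := ((isCompact_sphere (0 : W) 1).prod hB).exists_bound_of_continuousOn
    (continuous_uncurry_of_forall_continuous hL).continuousOn
  refine ⟨M, fun w x hx => ?_⟩
  rcases eq_or_ne w 0 with rfl | hw
  · simp
  · have := hM (‖w‖⁻¹ • w, x) ⟨by simp [norm_smul, hw], hx⟩
    simp only [Function.uncurry_apply_pair, map_smul, Pi.smul_apply, norm_smul, norm_inv,
      norm_norm] at this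
    rwa [inv_mul_le_iff₀ (norm_pos_iff.2 hw), mul_comm] at this

end FiniteDimensionalFamilies

theorem mul_measure_sub_le_setIntegral {X : Type*} [MeasurableSpace X] {μ : Measure X}
    {K : Set X} {g : X → ℝ} (hK : MeasurableSet K) (hμK : μ K ≠ ⊤) (hg : IntegrableOn g K μ)
    (hg0 : 0 ≤ g) {ε : ℝ} (hε : 0 ≤ ε) :
    ε * (μ.real K - μ.real {x ∈ K | g x ≤ ε}) ≤ ∫ x in K, g x ∂μ := by
  have hsub : μ.real K ≤ μ.real {x ∈ K | g x ≤ ε} + μ.real ({x | ε ≤ g x} ∩ K) := by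
    refine (measureReal_mono (fun x hx => ?_) ?_).trans (measureReal_union_le _ _)
    · exact (le_total (g x) ε).imp (⟨hx, ·⟩) (⟨·, hx⟩)
    · exact measure_union_ne_top (measure_ne_top_of_subset (sep_subset _ _) hμK)
        (measure_ne_top_of_subset inter_subset_right hμK)
  calc ε * (μ.real K - μ.real {x ∈ K | g x ≤ ε}) ≤ ε * μ.real ({x | ε ≤ g x} ∩ K) := by
        gcongr; linarith
    _ = ε * (μ.restrict K).real {x | ε ≤ g x} := by rw [measureReal_restrict_apply' hK]
    _ ≤ ∫ x in K, g x ∂μ :=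
        mul_meas_ge_le_integral_of_nonneg (Eventually.of_forall hg0) hg ε

/-! ### Korn's inequality -/

section Korn

variable {d : ℕ} {v w : E d → E d}

/-- The pointwise squared Frobenius norm `|ε(v)|²`, the integrand of `strainNormSq`. -/
noncomputable def strainSq (v : E d → E d) (x : E d) : ℝ := ∑ i, ∑ j, strain v x i j ^ 2

theorem strainSq_nonneg (v : E d → E d) : 0 ≤ strainSq v := fun _ => by
  unfold strainSq; positivity

theorem strainSq_eq_zero_iff : strainSq v = 0 ↔ strain v = 0 := by
  simp only [funext_iff, strainSq, Pi.zero_apply]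
  refine forall_congr' fun x => ?_
  rw [Finset.sum_eq_zero_iff_of_nonneg fun i _ => by positivity]
  simp [Finset.sum_eq_zero_iff_of_nonneg, sq_nonneg]

theorem strainNormSq_nonneg (v : E d → E d) (T : Set (E d)) : 0 ≤ strainNormSq v T :=
  integral_nonneg (strainSq_nonneg v)

theorem strain_add (hv : Differentiable ℝ v) (hw : Differentiable ℝ w) :
    strain (v + w) = strain v + strain w := by
  ext x i j
  simp only [strain, Pi.add_apply, fderiv_add (hv x) (hw x), add_apply, PiLp.add_apply]
  ring

theorem strain_smul (c : ℝ) (hv : Differentiable ℝ v) : strain (c • v) = c • strain v := by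
  ext x i j
  simp only [strain, Pi.smul_apply, fderiv_const_smul (hv x), smul_apply, PiLp.smul_apply,
    smul_eq_mul]
  ring

theorem analyticOnNhd_strain (hv : AnalyticOnNhd ℝ v univ) (i j : Fin d) :
    AnalyticOnNhd ℝ (fun x => strain v x i j) univ := by
  let entry (i j : Fin d) : (E d →L[ℝ] E d) →L[ℝ] ℝ :=
    (EuclideanSpace.proj i).comp (ContinuousLinearMap.apply ℝ (E d) (EuclideanSpace.single j 1))
  have h (i j : Fin d) : AnalyticOnNhd ℝ (fun x => entry i j (fderiv ℝ v x)) univ := fun x hx =>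
    ((entry i j).analyticAt _).comp (hv.fderiv x hx)
  exact fun x hx => ((h i j x hx).add (h j i x hx)).div_const

theorem analyticOnNhd_strainSq (hv : AnalyticOnNhd ℝ v univ) :
    AnalyticOnNhd ℝ (strainSq v) univ := fun x hx =>
  Finset.analyticAt_fun_sum _ fun i _ => Finset.analyticAt_fun_sum _ fun j _ =>
    (analyticOnNhd_strain hv i j x hx).pow 2

variable {P : Submodule ℝ (E d → E d)}

/-- The strain `v ↦ ε(v)` as a linear map on a space of differentiable fields. -/
noncomputable def strainMap (hP : ∀ v ∈ P, Differentiable ℝ v) :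
    P →ₗ[ℝ] E d → Fin d → Fin d → ℝ where
  toFun v := strain v.1
  map_add' v w := strain_add (hP _ v.2) (hP _ w.2)
  map_smul' c v := strain_smul c (hP _ v.2)

section StrainSublevel

variable {W : Type*} [NormedAddCommGroup W] [NormedSpace ℝ W] [FiniteDimensional ℝ W]
  {L : W →ₗ[ℝ] P}

theorem continuous_uncurry_strainSq (hP : ∀ v ∈ P, Differentiable ℝ v)
    (hL : ∀ w, AnalyticOnNhd ℝ (L w : E d → E d) univ) :
    Continuous (Function.uncurry fun w => strainSq (L w : E d → E d)) := by
  have hcont : Continuous (Function.uncurry fun w => (strainMap hP ∘ₗ L) w) :=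
    continuous_uncurry_of_forall_continuous fun w =>
      continuous_pi fun i => continuous_pi fun j => (analyticOnNhd_strain (hL w) i j).continuous
  have hentry (i j : Fin d) : Continuous fun q : W × E d => strain (L q.1 : E d → E d) q.2 i j :=
    (continuous_apply_apply i j).comp hcont
  simp only [Function.uncurry_def, strainSq]
  fun_prop

theorem exists_forall_measure_strainSq_sublevel_lt (hP : ∀ v ∈ P, Differentiable ℝ v)
    (hL : ∀ w, AnalyticOnNhd ℝ (L w : E d → E d) univ)
    (hinj : ∀ w, strain (L w : E d → E d) = 0 → w = 0) {B : Set (E d)} (hB : IsCompact B)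
    {c : ENNReal} (hc : 0 < c) : ∃ δ : ℝ, 0 < δ ∧
      ∀ w ≠ 0, volume {x ∈ B | strainSq (L w : E d → E d) x ≤ δ * ‖w‖ ^ 2} < c := by
  have hhom (t : ℝ) (w : W) (x : E d) :
      strainSq (L (t • w) : E d → E d) x = |t| ^ 2 * strainSq (L w : E d → E d) x := by
    simp only [strainSq, map_smul, Submodule.coe_smul, strain_smul t (hP _ (L w).2),
      Pi.smul_apply, smul_eq_mul, mul_pow, Finset.mul_sum, sq_abs]
  refine exists_forall_measure_sublevel_mul_norm_pow_lt (continuous_uncurry_strainSq hP hL) hhom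
    hB fun w hw => ?_
  have hnull := measure_zeros_eq_zero_of_analyticOnNhd volume (analyticOnNhd_strainSq (hL w))
    fun h => hw (hinj w (strainSq_eq_zero_iff.1 h))
  exact (measure_mono_null (fun x hx => hx.2.antisymm (strainSq_nonneg _ x)) hnull).trans_lt hc

end StrainSublevel

theorem exists_rigidMotion_norm_sub_sq_le [FiniteDimensional ℝ P]
    (hP : ∀ v ∈ P, AnalyticOnNhd ℝ v univ) {B : Set (E d)} (hB : IsCompact B) {ρ : ℝ}
    (hρ : 0 < ρ) : ∃ C : ℝ, 0 ≤ C ∧ ∀ v ∈ P, ∀ K ⊆ B, MeasurableSet K → ρ ≤ volume.real K →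
      ∃ r ∈ rigidMotion d, ∀ x ∈ B, ‖v x - r x‖ ^ 2 ≤ C * strainNormSq v K := by
  have hdiff : ∀ v ∈ P, Differentiable ℝ v := fun v hv x =>
    (hP v hv x trivial).differentiableAt
  obtain ⟨n, L, hinj, hsurj⟩ := exists_linearMap_parametrizing_range (strainMap hdiff)
  have hLan (a) : AnalyticOnNhd ℝ (L a : E d → E d) univ := hP _ (L a).2
  obtain ⟨M, hLM⟩ := exists_forall_norm_le_mul_norm (L := P.subtype ∘ₗ L)
    (fun a => (hLan a).continuous) hB
  obtain ⟨δ, hδ, hsub⟩ := exists_forall_measure_strainSq_sublevel_lt hdiff hLan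
    hinj hB (ENNReal.ofReal_pos.2 (half_pos hρ))
  refine ⟨2 * M ^ 2 / (δ * ρ), by positivity, fun v hv K hKB hK hρK => ?_⟩
  obtain ⟨a, ha⟩ := hsurj ⟨v, hv⟩
  have hstrain : strain (L a : E d → E d) = strain v := ha
  have hKtop : volume K ≠ ⊤ := measure_ne_top_of_subset hKB hB.measure_lt_top.ne
  have hlower : δ * ‖a‖ ^ 2 * (ρ / 2) ≤ strainNormSq v K := by
    rcases eq_or_ne a 0 with rfl | ha0
    · simpa using strainNormSq_nonneg v K
    have hreal : volume.real {x ∈ K | strainSq (L a) x ≤ δ * ‖a‖ ^ 2} ≤ ρ / 2 :=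
      ENNReal.toReal_le_of_le_ofReal (half_pos hρ).le
        ((measure_mono fun x hx => And.imp_left (@hKB x) hx).trans (hsub a ha0).le)
    calc δ * ‖a‖ ^ 2 * (ρ / 2)
        ≤ δ * ‖a‖ ^ 2 * (volume.real K -
            volume.real {x ∈ K | strainSq (L a) x ≤ δ * ‖a‖ ^ 2}) := by gcongr; linarith
      _ ≤ ∫ x in K, strainSq (L a) x :=
          mul_measure_sub_le_setIntegral hK hKtop
            (((analyticOnNhd_strainSq (hLan a)).continuous.continuousOn.integrableOn_compact
              hB).mono_set hKB) (strainSq_nonneg _) (by positivity)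
      _ = strainNormSq v K := by simp only [strainNormSq, strainSq, hstrain]
  refine ⟨v - L a, mem_rigidMotion_of_strain_eq_zero ?_ ?_, fun x hx => ?_⟩
  · exact ((hP v hv).contDiff.sub (hLan a).contDiff)
  · have : strainMap hdiff (⟨v, hv⟩ - L a) = 0 := by rw [map_sub, ha, sub_self]
    exact this
  · rw [Pi.sub_apply, sub_sub_cancel]
    calc ‖(L a : E d → E d) x‖ ^ 2 ≤ (M * ‖a‖) ^ 2 := by gcongr; exact hLM a x hx
      _ = 2 * M ^ 2 / (δ * ρ) * (δ * ‖a‖ ^ 2 * (ρ / 2)) := by field_simp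
      _ ≤ 2 * M ^ 2 / (δ * ρ) * strainNormSq v K := by gcongr

end Korn

/-! ### Flat sets -/

section Flat

theorem exists_linearIsometry_range_eq_orthogonal {V : Type*} [NormedAddCommGroup V]
    [InnerProductSpace ℝ V] {m : ℕ} (hV : Module.finrank ℝ V = m + 1) {n : V} (hn : n ≠ 0) :
    ∃ L : E m →ₗᵢ[ℝ] V, ∀ z, z ∈ range L ↔ inner ℝ n z = 0 := by
  have : Fact (Module.finrank ℝ V = m + 1) := ⟨hV⟩
  let b := OrthonormalBasis.fromOrthogonalSpanSingleton (𝕜 := ℝ) m hn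
  refine ⟨(Submodule.subtypeₗᵢ _).comp b.repr.symm.toLinearIsometry, fun z => ?_⟩
  rw [← Submodule.mem_orthogonal_singleton_iff_inner_right]
  refine ⟨?_, fun hz => ⟨b.repr ⟨z, hz⟩, by simp⟩⟩
  rintro ⟨y, rfl⟩
  exact (b.repr.symm y).2

theorem euclideanHausdorffMeasure_eq_volume_preimage {V : Type*} [NormedAddCommGroup V]
    [InnerProductSpace ℝ V] [MeasurableSpace V] [BorelSpace V] {m : ℕ} {L : E m →ₗᵢ[ℝ] V} {p : V}
    {e : Set V} (he : ∀ x ∈ e, x - p ∈ range L) : μHE[m] e = volume {y | p + L y ∈ e} := by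
  have hiso : Isometry fun y => p + L y := (IsometryEquiv.addLeft p).isometry.comp L.isometry
  rw [← EuclideanSpace.euclideanHausdorffMeasure_eq_volume, ← hiso.euclideanHausdorffMeasure_image]
  refine congrArg _ (Subset.antisymm (fun x hx => ?_) (image_subset_iff.2 fun y hy => hy))
  obtain ⟨y, hy⟩ := he x hx
  have hyx : p + L y = x := by rw [hy, add_sub_cancel]
  exact ⟨y, show p + L y ∈ e by rwa [hyx], hyx⟩

variable {d : ℕ} {e : Set (E d)} {n : E d} {s : ℝ}

theorem exists_linearIsometry_euclideanHausdorffMeasure_eq (hn : n ≠ 0) {p : E d}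
    (hp : inner ℝ n p = s) (he : ∀ x ∈ e, inner ℝ n x = s) :
    ∃ L : E (d - 1) →ₗᵢ[ℝ] E d, (∀ z, z ∈ range L ↔ inner ℝ n z = 0) ∧
      μHE[d - 1] e = volume {y | p + L y ∈ e} := by
  have hd : Module.finrank ℝ (E d) = d - 1 + 1 := by
    have : d ≠ 0 := by rintro rfl; exact hn (Subsingleton.elim _ _)
    rw [finrank_euclideanSpace_fin, Nat.sub_add_cancel (Nat.one_le_iff_ne_zero.2 this)]
  obtain ⟨L, hL⟩ := exists_linearIsometry_range_eq_orthogonal hd hn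
  refine ⟨L, hL, euclideanHausdorffMeasure_eq_volume_preimage fun x hx => (hL _).2 ?_⟩
  rw [inner_sub_right, he x hx, hp, sub_self]

theorem euclideanHausdorffMeasure_le_of_flat (hn : n ≠ 0) (he : ∀ x ∈ e, inner ℝ n x = s)
    (hb : Bornology.IsBounded e) :
    μHE[d - 1] e ≤ volume (Metric.closedBall (0 : E (d - 1)) (Metric.diam e)) := by
  rcases e.eq_empty_or_nonempty with rfl | ⟨x₀, hx₀⟩
  · simp
  obtain ⟨L, -, hmeas⟩ := exists_linearIsometry_euclideanHausdorffMeasure_eq hn (he x₀ hx₀) he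
  rw [hmeas]
  refine measure_mono fun y hy => ?_
  have hdist := Metric.dist_le_diam_of_mem hb hy hx₀
  rwa [dist_self_add_left, L.norm_map, ← mem_closedBall_zero_iff] at hdist

theorem exists_forall_mul_norm_le_abs_inner_add {V : Type*} [NormedAddCommGroup V]
    [InnerProductSpace ℝ V] [FiniteDimensional ℝ V] [MeasurableSpace V] [BorelSpace V]
    (μ : Measure V) [μ.IsAddHaarMeasure] {B : Set V} (hB : IsCompact B) {c : ENNReal}
    (hc : 0 < c) : ∃ δ : ℝ, 0 < δ ∧ ∀ K ⊆ B, c ≤ μ K → ∀ q : V × ℝ,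
      ∃ y ∈ K, δ * ‖q‖ ≤ |inner ℝ q.1 y + q.2| := by
  have hnull (q : V × ℝ) (hq : q ≠ 0) : μ {y ∈ B | |inner ℝ q.1 y + q.2| ≤ 0} = 0 := by
    have han : AnalyticOnNhd ℝ (fun y => inner ℝ q.1 y + q.2) univ := fun y _ =>
      ((innerSL ℝ q.1).analyticAt y).add analyticAt_const
    have hne : (fun y => inner ℝ q.1 y + q.2) ≠ 0 := fun h => hq <| by
      have h2 : q.2 = 0 := by simpa using congrFun h 0
      exact Prod.ext (by simpa [h2] using congrFun h q.1) h2
    exact measure_mono_null (fun y hy => abs_nonpos_iff.1 hy.2)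
      (measure_zeros_eq_zero_of_analyticOnNhd μ han hne)
  obtain ⟨δ, hδ, h⟩ := exists_forall_measure_sublevel_mul_norm_pow_lt (μ := μ) (p := 1)
    (F := fun (q : V × ℝ) y => |inner ℝ q.1 y + q.2|) (by fun_prop)
    (fun t q y => by simp [inner_smul_left, ← mul_add, abs_mul]) hB
    (fun q hq => (hnull q hq).trans_lt hc)
  refine ⟨δ, hδ, fun K hK hcK q => ?_⟩
  rcases eq_or_ne q 0 with rfl | hq
  · obtain ⟨y, hy⟩ : K.Nonempty := nonempty_of_measure_ne_zero (hc.trans_le hcK).ne'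
    exact ⟨y, hy, by simp⟩
  · by_contra! hcon
    refine (h q hq).not_ge (hcK.trans (measure_mono fun y hy => ⟨hK hy, ?_⟩))
    simpa using (hcon y hy).le

theorem norm_smul_add_map_le {V W : Type*} [NormedAddCommGroup V] [NormedSpace ℝ V]
    [NormedAddCommGroup W] [NormedSpace ℝ W] (L : W →ₗᵢ[ℝ] V) {n : V} (hn : ‖n‖ = 1) {σ H : ℝ}
    (hσ : 0 < σ) (hH : σ ≤ H) (w : W) (β : ℝ) :
    ‖β • n + L w‖ ≤ (1 / σ + 1) * ‖(w, β * H)‖ := by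
  have hβ : |β| * σ ≤ ‖(w, β * H)‖ := by
    calc |β| * σ ≤ |β| * H := by gcongr
      _ = ‖β * H‖ := by rw [norm_mul, Real.norm_eq_abs, Real.norm_of_nonneg (hσ.le.trans hH)]
      _ ≤ ‖(w, β * H)‖ := norm_snd_le (w, β * H)
  calc ‖β • n + L w‖ ≤ ‖β • n‖ + ‖L w‖ := norm_add_le _ _
    _ = |β| + ‖w‖ := by rw [norm_smul, hn, mul_one, L.norm_map, Real.norm_eq_abs]
    _ ≤ ‖(w, β * H)‖ / σ + ‖(w, β * H)‖ :=
      add_le_add ((le_div_iff₀ hσ).2 hβ) (norm_fst_le (w, β * H))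
    _ = (1 / σ + 1) * ‖(w, β * H)‖ := by ring

/-- With `w = β n + L w'` and `x - A = H n + L y`, where `H ≥ σ` is the height of the apex,
`⟪w, x - A⟫ = ⟪w', y⟫ + β H`. -/
theorem exists_forall_mul_norm_le_abs_inner_sub (d : ℕ) (R : ℝ) {c : ENNReal} (hc : 0 < c) {σ : ℝ}
    (hσ : 0 < σ) : ∃ δ : ℝ, 0 < δ ∧ ∀ (e : Set (E d)) (A n : E d) (s : ℝ),
      e ⊆ Metric.closedBall A R → ‖n‖ = 1 → (∀ x ∈ e, inner ℝ n x = s) → σ ≤ s - inner ℝ n A →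
      c ≤ μHE[d - 1] e → ∀ w, ∃ x ∈ e, δ * ‖w‖ ≤ |inner ℝ w (x - A)| := by
  obtain ⟨δ, hδ, h⟩ := exists_forall_mul_norm_le_abs_inner_add volume
    (isCompact_closedBall (0 : E (d - 1)) R) hc
  refine ⟨δ / (1 / σ + 1), by positivity, fun e A n s heB hn he hs hce w => ?_⟩
  set H := s - inner ℝ n A with hH
  have hnn : inner ℝ n n = 1 := by rw [real_inner_self_eq_norm_sq, hn, one_pow]
  obtain ⟨L, hL, hmeas⟩ := exists_linearIsometry_euclideanHausdorffMeasure_eq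
    (norm_ne_zero_iff.1 (hn.trans_ne one_ne_zero)) (p := A + H • n)
    (by rw [inner_add_right, inner_smul_right, hnn, hH]; ring) he
  have hLn (y) : inner ℝ n (L y) = 0 := (hL _).1 ⟨y, rfl⟩
  obtain ⟨β, w', rfl⟩ : ∃ (β : ℝ) (w' : E (d - 1)), w = β • n + L w' := by
    obtain ⟨w', hw'⟩ := (hL (w - inner ℝ n w • n)).2
      (by rw [inner_sub_right, inner_smul_right, hnn, mul_one, sub_self])
    exact ⟨inner ℝ n w, w', by rw [hw', add_sub_cancel]⟩
  have hsub (y) : A + H • n + L y - A = H • n + L y := by abel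
  have hball : {y | A + H • n + L y ∈ e} ⊆ Metric.closedBall 0 R := fun y hy => by
    have hpyth := norm_add_sq_eq_norm_sq_add_norm_sq_real
      (show inner ℝ (H • n) (L y) = 0 by rw [inner_smul_left, hLn, mul_zero])
    have hyR := mem_closedBall_iff_norm.1 (heB hy)
    rw [hsub] at hyR
    rw [mem_closedBall_zero_iff, ← L.norm_map]
    nlinarith [norm_nonneg (H • n), norm_nonneg (L y), norm_nonneg (H • n + L y)]
  obtain ⟨y, hy, hyδ⟩ := h _ hball (hmeas ▸ hce) (w', β * H)
  refine ⟨_, hy, ?_⟩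
  calc δ / (1 / σ + 1) * ‖β • n + L w'‖ ≤ δ / (1 / σ + 1) * ((1 / σ + 1) * ‖(w', β * H)‖) := by
        gcongr
        exact norm_smul_add_map_le L hn hσ hs w' β
    _ = δ * ‖(w', β * H)‖ := by field_simp
    _ ≤ |inner ℝ w' y + β * H| := hyδ
    _ = |inner ℝ (β • n + L w') (A + H • n + L y - A)| := by
      simp only [hsub, inner_add_left, inner_add_right, inner_smul_left, inner_smul_right, hnn,
        hLn, real_inner_comm n (L _), L.inner_map_map, conj_trivial]
      ring_nf

end Flat

/-! ### Simplices with a distinguished apex -/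

theorem exists_forall_mem_pow_le_abs_det {ι V : Type*} [Fintype ι] [DecidableEq ι]
    [NormedAddCommGroup V] [InnerProductSpace ℝ V] (b : OrthonormalBasis ι ℝ V) {K : Set V} {δ : ℝ}
    (hδ : 0 ≤ δ) (h : ∀ w, ∃ x ∈ K, δ * ‖w‖ ≤ |inner ℝ w x|) :
    ∃ q : ι → V, (∀ i, q i ∈ K) ∧ δ ^ Fintype.card ι ≤ |b.toBasis.det q| := by
  have : FiniteDimensional ℝ V := b.toBasis.finiteDimensional_of_finite
  have hreplace (s : Finset ι) : ∃ q : ι → V, (∀ i ∈ s, q i ∈ K) ∧ (∀ i ∉ s, q i = b i) ∧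
      δ ^ s.card ≤ |b.toBasis.det q| := by
    induction s using Finset.induction_on with
    | empty => exact ⟨b, by simp, by simp, by
      rw [← b.coe_toBasis, b.toBasis.det_self, Finset.card_empty, pow_zero, abs_one]⟩
    | insert j s hj ih =>
      obtain ⟨q, hqK, hqb, hq⟩ := ih
      let w := (InnerProductSpace.toDual ℝ V).symm
        (b.toBasis.det.toMultilinearMap.toLinearMap q j).toContinuousLinearMap
      have hw (x) : inner ℝ w x = b.toBasis.det (Function.update q j x) :=
        InnerProductSpace.toDual_symm_apply
      have hqw : |b.toBasis.det q| ≤ ‖w‖ := by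
        have hdet := hw (b j)
        rw [← hqb j hj, Function.update_eq_self, hqb j hj] at hdet
        simpa [← hdet] using abs_real_inner_le_norm w (b j)
      obtain ⟨x, hx, hxw⟩ := h w
      refine ⟨Function.update q j x, fun i hi => ?_, fun i hi => ?_, ?_⟩
      · rcases eq_or_ne i j with rfl | hij
        · simpa using hx
        · simpa [hij] using hqK i (Finset.mem_of_mem_insert_of_ne hi hij)
      · obtain ⟨hij, his⟩ : i ≠ j ∧ i ∉ s := by simpa using hi
        simpa [hij] using hqb i his
      · rw [Finset.card_insert_of_notMem hj, pow_succ', ← hw]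
        exact (mul_le_mul_of_nonneg_left (hq.trans hqw) hδ).trans hxw
  obtain ⟨q, hqK, -, hq⟩ := hreplace Finset.univ
  exact ⟨q, fun i => hqK i (Finset.mem_univ i), hq⟩

theorem affineMap_eq_zero_of_forall_nonpos {V : Type*} [AddCommGroup V] [Module ℝ V]
    {f g : V →ᵃ[ℝ] ℝ} {B : Set V} (hB : Convex ℝ B) {a y : V} (ha : a ∈ B) (hfa : 0 < f a)
    (hga : 0 < g a) (hfg : ∀ z ∈ B, f z = 0 → g z ≤ 0) (hgf : ∀ z ∈ B, g z = 0 → f z ≤ 0)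
    (hy : y ∈ B) (hfy : f y = 0) : g y = 0 := by
  by_contra hne
  have hgy : g y < 0 := (hfg y hy hfy).lt_of_ne hne
  have hgap : 0 < g a - g y := by linarith
  set t := -g y / (g a - g y) with ht
  have ht0 : 0 < t := div_pos (neg_pos.2 hgy) hgap
  have ht1 : t ≤ 1 := (div_le_one hgap).2 (by linarith)
  have hz : AffineMap.lineMap y a t ∈ B := hB.lineMap_mem hy ha ⟨ht0.le, ht1⟩
  refine (hgf _ hz ?_).not_gt ?_
  · rw [AffineMap.apply_lineMap, AffineMap.lineMap_apply_ring', ht, div_mul_cancel₀ _ hgap.ne',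
      neg_add_cancel]
  · rw [AffineMap.apply_lineMap, AffineMap.lineMap_apply_ring', hfy]
    simpa using mul_pos ht0 hfa

section ApexedSimplex

/-- A simplex in `E d`, given by its apex and the `d` vertices of the opposite facet, its base. It
may be degenerate. -/
abbrev ApexedSimplex (d : ℕ) := E d × (Fin d → E d)

variable {d : ℕ}

/-- The matrix whose columns are the edge vectors from the apex to the base vertices. -/
noncomputable def edgeMatrix (q : ApexedSimplex d) : Matrix (Fin d) (Fin d) ℝ :=
  (EuclideanSpace.basisFun (Fin d) ℝ).toBasis.toMatrix fun i => q.2 i - q.1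

/-- The barycentric coordinates belonging to the base vertices, for a nondegenerate simplex. -/
noncomputable def baseCoord (q : ApexedSimplex d) : E d →ᵃ[ℝ] Fin d → ℝ :=
  ((edgeMatrix q)⁻¹.mulVecLin ∘ₗ (WithLp.linearEquiv 2 ℝ (Fin d → ℝ)).toLinearMap).toAffineMap.comp
    (AffineMap.id ℝ (E d) - AffineMap.const ℝ (E d) q.1)

/-- The barycentric coordinate belonging to the apex, for a nondegenerate simplex. -/
noncomputable def apexCoord (q : ApexedSimplex d) : E d →ᵃ[ℝ] ℝ :=
  AffineMap.const ℝ (E d) 1 - (∑ i, LinearMap.proj i).toAffineMap.comp (baseCoord q)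

/-- The barycenter of the base. -/
noncomputable def baseCenter (q : ApexedSimplex d) : E d := (d : ℝ)⁻¹ • ∑ i, q.2 i

theorem baseCoord_apply (q : ApexedSimplex d) (y : E d) :
    baseCoord q y = (edgeMatrix q)⁻¹.mulVec (y - q.1).ofLp := by
  simp [baseCoord]

theorem apexCoord_apply (q : ApexedSimplex d) (y : E d) :
    apexCoord q y = 1 - ∑ i, baseCoord q y i := by
  simp [apexCoord]

theorem edgeMatrix_mulVec (q : ApexedSimplex d) (c : Fin d → ℝ) :
    (edgeMatrix q).mulVec c = (∑ i, c i • (q.2 i - q.1)).ofLp := by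
  ext i
  simp [edgeMatrix, Module.Basis.toMatrix_apply, Matrix.mulVec, dotProduct, mul_comm]

theorem baseCoord_add_sum {q : ApexedSimplex d} (hq : (edgeMatrix q).det ≠ 0) (c : Fin d → ℝ) :
    baseCoord q (q.1 + ∑ i, c i • (q.2 i - q.1)) = c := by
  rw [baseCoord_apply, add_sub_cancel_left, ← edgeMatrix_mulVec, Matrix.mulVec_mulVec,
    Matrix.nonsing_inv_mul _ (isUnit_iff_ne_zero.2 hq), Matrix.one_mulVec]

theorem add_sum_baseCoord {q : ApexedSimplex d} (hq : (edgeMatrix q).det ≠ 0) (y : E d) :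
    q.1 + ∑ i, baseCoord q y i • (q.2 i - q.1) = y := by
  have h : (∑ i, baseCoord q y i • (q.2 i - q.1)).ofLp = (y - q.1).ofLp := by
    rw [← edgeMatrix_mulVec, baseCoord_apply, Matrix.mulVec_mulVec,
      Matrix.mul_nonsing_inv _ (isUnit_iff_ne_zero.2 hq), Matrix.one_mulVec]
  rw [WithLp.ofLp_injective 2 h, add_sub_cancel]

theorem sum_baseCoord_add_apexCoord {q : ApexedSimplex d} (hq : (edgeMatrix q).det ≠ 0) (y : E d) :
    ∑ i, baseCoord q y i • q.2 i + apexCoord q y • q.1 = y := by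
  conv_rhs => rw [← add_sum_baseCoord hq y]
  simp only [apexCoord_apply, smul_sub, Finset.sum_sub_distrib, sub_smul, Finset.sum_smul, one_smul]
  abel

theorem continuous_edgeMatrix :
    Continuous (edgeMatrix : ApexedSimplex d → Matrix (Fin d) (Fin d) ℝ) := by
  refine continuous_matrix fun i j => ?_
  simp only [edgeMatrix, Module.Basis.toMatrix_apply, OrthonormalBasis.coe_toBasis_repr_apply,
    EuclideanSpace.basisFun_repr]
  fun_prop

theorem continuousAt_baseCoord {q : ApexedSimplex d} (hq : (edgeMatrix q).det ≠ 0) (y : E d) :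
    ContinuousAt (fun r : ApexedSimplex d × E d => baseCoord r.1 r.2) (q, y) := by
  simp only [baseCoord_apply, Matrix.inv_def, Ring.inverse_eq_inv', Matrix.smul_mulVec]
  have hmat : Continuous fun r : ApexedSimplex d × E d => edgeMatrix r.1 :=
    continuous_edgeMatrix.comp continuous_fst
  have hvec : Continuous fun r : ApexedSimplex d × E d => (r.2 - r.1.1).ofLp := by fun_prop
  have hdet : ContinuousAt (fun r : ApexedSimplex d × E d => (edgeMatrix r.1).det⁻¹) (q, y) :=
    hmat.matrix_det.continuousAt.inv₀ hq
  exact hdet.smul (hmat.matrix_adjugate.matrix_mulVec hvec).continuousAt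

theorem continuousAt_apexCoord {q : ApexedSimplex d} (hq : (edgeMatrix q).det ≠ 0) (y : E d) :
    ContinuousAt (fun r : ApexedSimplex d × E d => apexCoord r.1 r.2) (q, y) := by
  have hbase := continuousAt_baseCoord hq y
  simp only [apexCoord_apply]
  fun_prop

theorem baseCoord_baseCenter [NeZero d] {q : ApexedSimplex d} (hq : (edgeMatrix q).det ≠ 0) :
    baseCoord q (baseCenter q) = fun _ => (d : ℝ)⁻¹ := by
  have hd : (d : ℝ) ≠ 0 := NeZero.ne _
  have hcenter : baseCenter q = q.1 + ∑ i, (d : ℝ)⁻¹ • (q.2 i - q.1) := by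
    simp [baseCenter, smul_sub, Finset.sum_sub_distrib, Finset.smul_sum,
      ← Nat.cast_smul_eq_nsmul ℝ, smul_smul, hd]
  rw [hcenter, baseCoord_add_sum hq fun _ => (d : ℝ)⁻¹]

theorem apexCoord_baseCenter [NeZero d] {q : ApexedSimplex d} (hq : (edgeMatrix q).det ≠ 0) :
    apexCoord q (baseCenter q) = 0 := by
  have hd : (d : ℝ) ≠ 0 := NeZero.ne _
  simp [apexCoord_apply, baseCoord_baseCenter hq, hd]

theorem apexCoord_apex (q : ApexedSimplex d) : apexCoord q q.1 = 1 := by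
  simp [apexCoord_apply, baseCoord_apply]

theorem inner_baseCenter [NeZero d] {q : ApexedSimplex d} {n : E d} {s : ℝ}
    (hqs : ∀ i, inner ℝ n (q.2 i) = s) : inner ℝ n (baseCenter q) = s := by
  have hd : (d : ℝ) ≠ 0 := NeZero.ne _
  simp [baseCenter, inner_smul_right, inner_sum, hqs, hd]

theorem apexCoord_eq_zero_of_inner_eq {q : ApexedSimplex d} (hq : (edgeMatrix q).det ≠ 0) {n : E d}
    {s : ℝ} (hs : inner ℝ n q.1 ≠ s) (hqs : ∀ i, inner ℝ n (q.2 i) = s) {y : E d}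
    (hy : inner ℝ n y = s) : apexCoord q y = 0 := by
  rw [← add_sum_baseCoord hq y, inner_add_right, inner_sum] at hy
  simp only [inner_smul_right, inner_sub_right, hqs, ← Finset.sum_mul] at hy
  have h : (s - inner ℝ n q.1) * apexCoord q y = 0 := by rw [apexCoord_apply]; linarith
  exact (mul_eq_zero.1 h).resolve_left (sub_ne_zero.2 hs.symm)

/-- In the ball of centre `g` and radius `R` the nondegenerate simplex `q` coincides with a half
space cut off by the hyperplane of its base: only the apex coordinate changes sign there. The point
`a` of the ball lies on the same side as the apex. Simplices that cut the same ball with the same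
point `a` are the ones whose bases are compared in counting the sides. -/
structure CutsBall (q : ApexedSimplex d) (g a : E d) (R : ℝ) : Prop where
  det_ne_zero : (edgeMatrix q).det ≠ 0
  baseCoord_pos : ∀ y ∈ Metric.ball g R, ∀ i, 0 < baseCoord q y i
  mem_ball : a ∈ Metric.ball g R
  apexCoord_pos : 0 < apexCoord q a
  baseCenter_mem : baseCenter q ∈ Metric.ball g R

theorem exists_eventually_cutsBall [NeZero d] {q : ApexedSimplex d} (hq : (edgeMatrix q).det ≠ 0) :
    ∃ (g a : E d) (R : ℝ), ∀ᶠ r in 𝓝 q, CutsBall r g a R := by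
  have hbase : ∀ᶠ r in 𝓝 q ×ˢ 𝓝 (baseCenter q), ∀ i, 0 < baseCoord r.1 r.2 i := by
    rw [← nhds_prod_eq]
    refine eventually_all.2 fun i =>
      (continuousAt_pi.1 (continuousAt_baseCoord hq _) i).eventually_const_lt ?_
    simpa only [baseCoord_baseCenter hq] using inv_pos.2 (Nat.cast_pos.2 (NeZero.pos d))
  obtain ⟨p₁, hp₁, p₂, hp₂, h12⟩ := eventually_prod_iff.1 hbase
  obtain ⟨R, hR, hball⟩ := Metric.eventually_nhds_iff_ball.1 hp₂
  have hline : ∀ᶠ t : ℝ in 𝓝[>] 0, AffineMap.lineMap (baseCenter q) q.1 t ∈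
      Metric.ball (baseCenter q) R := by
    refine mem_nhdsWithin_of_mem_nhds
      (AffineMap.lineMap_continuous.continuousAt.preimage_mem_nhds ?_)
    simpa using Metric.ball_mem_nhds _ hR
  obtain ⟨t, ha, ht⟩ := (hline.and self_mem_nhdsWithin).exists
  refine ⟨baseCenter q, AffineMap.lineMap (baseCenter q) q.1 t, R, ?_⟩
  have hdet : ∀ᶠ r in 𝓝 q, (edgeMatrix r).det ≠ 0 :=
    continuous_edgeMatrix.matrix_det.continuousAt.eventually_ne hq
  have hcenter : ∀ᶠ r in 𝓝 q, baseCenter r ∈ Metric.ball (baseCenter q) R := by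
    have hcont : Continuous (baseCenter : ApexedSimplex d → E d) := by
      unfold baseCenter
      fun_prop
    exact hcont.continuousAt (Metric.ball_mem_nhds _ hR)
  have hapex : ∀ᶠ r in 𝓝 q, 0 < apexCoord r (AffineMap.lineMap (baseCenter q) q.1 t) := by
    refine ((continuousAt_apexCoord hq _).comp (f := fun r => (r, _)) (x := q)
      (by fun_prop)).eventually_const_lt ?_
    simpa [AffineMap.lineMap_apply_ring', apexCoord_baseCenter hq, apexCoord_apex] using ht
  filter_upwards [hdet, hp₁, hapex, hcenter] with r hdet hr hapex hcenter
  exact ⟨hdet, fun y hy => h12 hr (hball y hy), ha, hapex, hcenter⟩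

end ApexedSimplex

/-! ### The number of convex sides -/

section ConvexSides

variable {d : ℕ}

theorem CutsBall.mem_of_apexCoord_eq_zero {q : ApexedSimplex d} {g a : E d} {R : ℝ}
    (hq : CutsBall q g a R) {e : Set (E d)} (he : Convex ℝ e) (hqe : ∀ i, q.2 i ∈ e) {y : E d}
    (hy : y ∈ Metric.ball g R) (hy0 : apexCoord q y = 0) : y ∈ e := by
  rw [← sum_baseCoord_add_apexCoord hq.det_ne_zero y, hy0, zero_smul, add_zero]
  refine he.sum_mem (fun i _ => (hq.baseCoord_pos y hy i).le) ?_ fun i _ => hqe i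
  rw [apexCoord_apply] at hy0
  linarith

/-- The simplex `q` spans part of the pyramid with base `e` and apex `q.1`, where this pyramid lies
in `T` and its base lies in a hyperplane that misses the apex. -/
structure IsInscribed (q : ApexedSimplex d) (T e : Set (E d)) : Prop where
  base_mem : ∀ i, q.2 i ∈ e
  segment_subset : ∀ x ∈ e, segment ℝ x q.1 ⊆ T
  flat : ∃ n s, (∀ x ∈ e, inner ℝ n x = s) ∧ inner ℝ n q.1 ≠ s

theorem CutsBall.mem_interior [NeZero d] {q : ApexedSimplex d} {g a : E d} {R : ℝ}
    (hq : CutsBall q g a R) {T e : Set (E d)} (he : Convex ℝ e) (hin : IsInscribed q T e) {y : E d}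
    (hy : y ∈ Metric.ball g R) (hy0 : 0 < apexCoord q y) : y ∈ interior T := by
  have hopen : IsOpen (Metric.ball g R ∩ {z | 0 < apexCoord q z}) := Metric.isOpen_ball.inter
    (isOpen_lt continuous_const (apexCoord q).continuous_of_finiteDimensional)
  refine interior_maximal (fun z hz => ?_) hopen ⟨hy, hy0⟩
  have hpos := hq.baseCoord_pos z hz.1
  have hz0 : 0 < apexCoord q z := hz.2
  have hsum : 0 < ∑ i, baseCoord q z i := Finset.sum_pos (fun i _ => hpos i) Finset.univ_nonempty
  have hmem := he.centerMass_mem (fun i _ => (hpos i).le) hsum fun i _ => hin.base_mem i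
  refine hin.segment_subset _ hmem ⟨∑ i, baseCoord q z i, apexCoord q z, hsum.le,
    hz0.le, by rw [apexCoord_apply, add_sub_cancel], ?_⟩
  rw [Finset.centerMass, smul_smul, mul_inv_cancel₀ hsum.ne', one_smul,
    sum_baseCoord_add_apexCoord hq.det_ne_zero]

theorem CutsBall.measure_inter_ne_zero [NeZero d] {q q' : ApexedSimplex d} {g a : E d} {R : ℝ}
    (hq : CutsBall q g a R) (hq' : CutsBall q' g a R) {T e e' : Set (E d)}
    (hin : IsInscribed q T e) (hin' : IsInscribed q' T e') (he : Convex ℝ e) (he' : Convex ℝ e')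
    (heT : e ⊆ frontier T) (heT' : e' ⊆ frontier T) : μHE[d - 1] (e ∩ e') ≠ 0 := by
  obtain ⟨n, s, hes, hs⟩ := hin.flat
  have hn : n ≠ 0 := by
    rintro rfl
    exact hs (by rw [← hes _ (hin.base_mem 0), inner_zero_left, inner_zero_left])
  have hqs (i) : inner ℝ n (q.2 i) = s := hes _ (hin.base_mem i)
  have hcenter := inner_baseCenter hqs
  obtain ⟨L, hL, hmeas⟩ := exists_linearIsometry_euclideanHausdorffMeasure_eq hn hcenter
    fun x (hx : x ∈ e ∩ e') => hes x hx.1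
  have hU : IsOpen ((fun y => baseCenter q + L y) ⁻¹' Metric.ball g R) :=
    Metric.isOpen_ball.preimage (by fun_prop)
  have hUpos := hU.measure_pos volume ⟨0, by simpa using hq.baseCenter_mem⟩
  refine hmeas ▸ (hUpos.trans_le (measure_mono fun y hy => ?_)).ne'
  have hy0 : apexCoord q (baseCenter q + L y) = 0 := by
    refine apexCoord_eq_zero_of_inner_eq hq.det_ne_zero hs hqs ?_
    rw [inner_add_right, hcenter, (hL _).1 ⟨y, rfl⟩, add_zero]
  have hmem {z} (hz : z ∈ Metric.ball g R) (hz0 : apexCoord q z = 0) : z ∈ e :=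
    hq.mem_of_apexCoord_eq_zero he hin.base_mem hz hz0
  have hmem' {z} (hz : z ∈ Metric.ball g R) (hz0 : apexCoord q' z = 0) : z ∈ e' :=
    hq'.mem_of_apexCoord_eq_zero he' hin'.base_mem hz hz0
  exact ⟨hmem hy hy0, hmem' hy <| affineMap_eq_zero_of_forall_nonpos (convex_ball g R) hq.mem_ball
    hq.apexCoord_pos hq'.apexCoord_pos
    (fun z hz hz0 => not_lt.1 fun h => (heT (hmem hz hz0)).2 (hq'.mem_interior he' hin' hz h))
    (fun z hz hz0 => not_lt.1 fun h => (heT' (hmem' hz hz0)).2 (hq.mem_interior he hin hz h))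
    hy hy0⟩

end ConvexSides

theorem exists_forall_card_le_of_isCompact {X ι : Type*} [TopologicalSpace X] {K : Set X}
    (hK : IsCompact K) {P : Set X → Prop} (hP : ∀ x ∈ K, ∃ U ∈ 𝓝 x, P U) :
    ∃ M : ℕ, ∀ (F : Finset ι) (q : ι → X), (∀ i ∈ F, q i ∈ K) →
      (∀ U, P U → (F ∩ q ⁻¹' U : Set ι).Subsingleton) → F.card ≤ M := by
  choose! U hU hPU using hP
  obtain ⟨t, htK, ht⟩ := hK.elim_nhds_subcover U hU
  refine ⟨t.card, fun F q hq hsub => ?_⟩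
  have hcover : ∀ i ∈ F, ∃ x ∈ t, q i ∈ U x := fun i hi => by
    simpa only [mem_iUnion, exists_prop] using ht (hq i hi)
  rcases F.eq_empty_or_nonempty with rfl | ⟨i₀, -⟩
  · simp
  have : Nonempty X := ⟨q i₀⟩
  choose! x hxt hqx using hcover
  refine Finset.card_le_card_of_injOn x hxt fun i hi j hj hij => ?_
  exact hsub _ (hPU _ (htK _ (hxt i hi))) ⟨hi, hqx i hi⟩ ⟨hj, hij ▸ hqx j hj⟩

theorem exists_forall_isInscribed (d : ℕ) (R : ℝ) {c : ENNReal} (hc : 0 < c) {η : ℝ} (hη : 0 < η) :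
    ∃ δ : ℝ, 0 < δ ∧ ∀ {T e : Set (E d)} {σ θ : ℝ}, T ⊆ Metric.closedBall 0 R →
      HasPyramid T e σ θ → η ≤ σ * Metric.diam T → c ≤ μHE[d - 1] e →
      ∃ q ∈ Metric.closedBall (0 : ApexedSimplex d) R, δ ≤ |(edgeMatrix q).det| ∧
        IsInscribed q T e := by
  obtain ⟨δ, hδ, h⟩ := exists_forall_mul_norm_le_abs_inner_sub d (R + R) hc hη
  refine ⟨δ ^ d, by positivity, fun {T e σ θ} hT ⟨A, n, s, hA, hn, hes, hseg, hheight, _⟩ hησ hce =>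
    ?_⟩
  have hseg' : ∀ x ∈ e, segment ℝ x A ⊆ T := fun x hx => (subset_biUnion_of_mem hx).trans hseg
  have heR : ∀ x ∈ e, x ∈ Metric.closedBall 0 R := fun x hx =>
    hT (hseg' x hx (left_mem_segment ℝ x A))
  have heA : e ⊆ Metric.closedBall A (R + R) := fun x hx => mem_closedBall_iff_norm.2 <|
    (norm_sub_le x A).trans
      (add_le_add (mem_closedBall_zero_iff.1 (heR x hx)) (mem_closedBall_zero_iff.1 (hT hA)))
  obtain ⟨p, hp, hdet⟩ := exists_forall_mem_pow_le_abs_det (EuclideanSpace.basisFun (Fin d) ℝ)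
    (K := (· - A) '' e) hδ.le fun w => by
      simpa only [exists_mem_image] using h e A n s heA hn hes (hησ.trans hheight) hce w
  choose x hxe hxp using hp
  obtain rfl : (fun i => x i - A) = p := funext hxp
  refine ⟨(A, x), ?_, by simpa [edgeMatrix, Module.Basis.det_apply] using hdet, hxe,
    hseg', n, s, hes, ?_⟩
  · rw [mem_closedBall_zero_iff, Prod.norm_def, max_le_iff,
      pi_norm_le_iff_of_nonneg ((norm_nonneg A).trans (mem_closedBall_zero_iff.1 (hT hA)))]
    exact ⟨mem_closedBall_zero_iff.1 (hT hA), fun i => mem_closedBall_zero_iff.1 (heR _ (hxe i))⟩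
  · exact (sub_pos.1 (hη.trans_le (hησ.trans hheight))).ne

theorem exists_forall_card_convex_sides_le (d : ℕ) [NeZero d] (R : ℝ) {c : ENNReal} (hc : 0 < c)
    {η : ℝ} (hη : 0 < η) :
    ∃ M : ℕ, ∀ {T : Set (E d)} {F : Finset (Set (E d))} {σ : ℝ}, T ⊆ Metric.closedBall 0 R →
      η ≤ σ * Metric.diam T → (∀ e ∈ F, Convex ℝ e) → (∀ e ∈ F, e ⊆ frontier T) →
      (∀ e ∈ F, ∃ θ, HasPyramid T e σ θ) → (∀ e ∈ F, c ≤ μHE[d - 1] e) →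
      (∀ e ∈ F, ∀ e' ∈ F, e ≠ e' → μHE[d - 1] (e ∩ e') = 0) → F.card ≤ M := by
  obtain ⟨δ, hδ, hins⟩ := exists_forall_isInscribed d R hc hη
  have hK : IsCompact (Metric.closedBall (0 : ApexedSimplex d) R ∩
      {q | δ ≤ |(edgeMatrix q).det|}) := (isCompact_closedBall _ _).inter_right
    (isClosed_le continuous_const continuous_edgeMatrix.matrix_det.abs)
  obtain ⟨M, hM⟩ := exists_forall_card_le_of_isCompact (ι := Set (E d)) hK
    (P := fun U => ∃ g a R, ∀ q ∈ U, CutsBall q g a R) fun q hq => by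
      have hdet : (edgeMatrix q).det ≠ 0 := abs_pos.1 (hδ.trans_le hq.2)
      obtain ⟨g, a, R, hev⟩ := exists_eventually_cutsBall hdet
      exact ⟨_, hev, g, a, R, fun _ hr => hr⟩
  refine ⟨M, fun {T F σ} hT hησ hconv hfront hpyr harea hdisj => ?_⟩
  have hq : ∀ e ∈ F, ∃ q ∈ Metric.closedBall (0 : ApexedSimplex d) R,
      δ ≤ |(edgeMatrix q).det| ∧ IsInscribed q T e := fun e he => by
    obtain ⟨θ, hθ⟩ := hpyr e he
    exact hins hT hθ hησ (harea e he)
  choose! q hqR hqδ hq using hq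
  refine hM F q (fun e he => ⟨hqR e he, hqδ e he⟩) ?_
  rintro U ⟨g, a, R, hcuts⟩ e ⟨he, heU⟩ e' ⟨he', heU'⟩
  by_contra hne
  exact (hcuts _ heU).measure_inter_ne_zero (hcuts _ heU') (hq e he) (hq e' he') (hconv e he)
    (hconv e' he') (hfront e he) (hfront e' he') (hdisj e he e' he' hne)

/-! ### Rescaling -/

section Rescale

open scoped Pointwise

variable {V : Type*} [NormedAddCommGroup V] [InnerProductSpace ℝ V] {x₀ : V} {h : ℝ}

/-- The similarity `z ↦ x₀ + h z`; pulling back along it with `h = h_T` reduces to elements of unit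
diameter. -/
noncomputable def rescale (x₀ : V) (hh : h ≠ 0) : V ≃ₜ V :=
  (Homeomorph.smulOfNeZero h hh).trans (Homeomorph.addLeft x₀)

theorem rescale_apply (hh : h ≠ 0) (z : V) : rescale x₀ hh z = x₀ + h • z := rfl

theorem rescale_symm_apply (hh : h ≠ 0) (x : V) : (rescale x₀ hh).symm x = h⁻¹ • (x - x₀) := by
  rw [Homeomorph.symm_apply_eq, rescale_apply, smul_inv_smul₀ hh, add_sub_cancel]

theorem addLeft_image_smul_preimage_rescale (hh : h ≠ 0) (S : Set V) :
    IsometryEquiv.addLeft x₀ '' (h • (rescale x₀ hh ⁻¹' S)) = S := by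
  rw [← image_smul, image_image]
  exact (rescale x₀ hh).image_preimage S

theorem diam_preimage_rescale (hh : 0 < h) (S : Set V) :
    Metric.diam (rescale x₀ hh.ne' ⁻¹' S) = Metric.diam S / h := by
  rw [eq_div_iff hh.ne']
  conv_rhs => rw [← addLeft_image_smul_preimage_rescale (x₀ := x₀) hh.ne' S,
    (IsometryEquiv.addLeft x₀).isometry.diam_image, diam_smul₀, Real.norm_of_nonneg hh.le, mul_comm]

theorem convex_preimage_rescale (hh : h ≠ 0) {S : Set V} :
    Convex ℝ (rescale x₀ hh ⁻¹' S) ↔ Convex ℝ S := by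
  refine ⟨fun hS => ?_, fun hS => (hS.translate_preimage_right x₀).smul_preimage h⟩
  rw [← addLeft_image_smul_preimage_rescale (x₀ := x₀) hh S]
  exact (hS.smul h).translate x₀

theorem rescale_mem_segment (hh : h ≠ 0) {x y z : V} (hz : z ∈ segment ℝ x y) :
    rescale x₀ hh z ∈ segment ℝ (rescale x₀ hh x) (rescale x₀ hh y) := by
  rw [← convexHull_pair] at hz ⊢
  refine convexHull_min ?_ ((convex_preimage_rescale hh).2 (convex_convexHull ℝ _)) hz
  exact fun w hw => subset_convexHull ℝ _ (by rcases hw with rfl | rfl <;> simp)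

variable [MeasurableSpace V] [BorelSpace V]

theorem euclideanHausdorffMeasure_eq_smul_map_rescale (m : ℕ) (hh : 0 < h) :
    (μHE[m] : Measure V) = ENNReal.ofReal (h ^ m) • (μHE[m]).map (rescale x₀ hh.ne') := by
  ext S hS
  rw [Measure.smul_apply, Measure.map_apply (rescale x₀ hh.ne').measurable hS]
  conv_lhs => rw [← addLeft_image_smul_preimage_rescale (x₀ := x₀) hh.ne' S,
    (IsometryEquiv.addLeft x₀).isometry.euclideanHausdorffMeasure_image,
    Measure.euclideanHausdorffMeasure_smul₀ m hh.ne', ENNReal.smul_def]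
  rw [ENNReal.ofReal_pow hh.le, ENNReal.coe_pow, ← enorm_eq_nnnorm, Real.enorm_of_nonneg hh.le]

theorem euclideanHausdorffMeasure_eq_mul_preimage_rescale (m : ℕ) (hh : 0 < h) (S : Set V) :
    μHE[m] S = ENNReal.ofReal (h ^ m) * μHE[m] (rescale x₀ hh.ne' ⁻¹' S) := by
  conv_lhs => rw [euclideanHausdorffMeasure_eq_smul_map_rescale (x₀ := x₀) m hh,
    Measure.smul_apply, smul_eq_mul, ← Homeomorph.toMeasurableEquiv_coe, MeasurableEquiv.map_apply]
  rfl

theorem euclideanHausdorffMeasure_real_preimage_rescale (m : ℕ) (hh : 0 < h) (S : Set V) :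
    (μHE[m]).real (rescale x₀ hh.ne' ⁻¹' S) = (μHE[m]).real S / h ^ m := by
  rw [eq_div_iff (by positivity), measureReal_def, measureReal_def,
    euclideanHausdorffMeasure_eq_mul_preimage_rescale (x₀ := x₀) m hh S, ENNReal.toReal_mul,
    ENNReal.toReal_ofReal (by positivity), mul_comm]

theorem setIntegral_euclideanHausdorffMeasure_eq_mul_rescale (m : ℕ) (hh : 0 < h) (S : Set V)
    (f : V → ℝ) : ∫ x in S, f x ∂μHE[m] =
      h ^ m * ∫ z in rescale x₀ hh.ne' ⁻¹' S, f (rescale x₀ hh.ne' z) ∂μHE[m] := by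
  conv_lhs => rw [euclideanHausdorffMeasure_eq_smul_map_rescale (x₀ := x₀) m hh,
    Measure.restrict_smul, integral_smul_measure, ENNReal.toReal_ofReal (by positivity),
    smul_eq_mul, ← Homeomorph.toMeasurableEquiv_coe, setIntegral_map_equiv]
  rfl

end Rescale

section RescaleField

variable {d k : ℕ} {x₀ : E d} {h : ℝ} {v r : E d → E d}

theorem totalDegree_aeval_le {σ τ R : Type*} [CommSemiring R] {f : σ → MvPolynomial τ R} {n : ℕ}
    (hf : ∀ j, (f j).totalDegree ≤ n) (p : MvPolynomial σ R) :
    (MvPolynomial.aeval f p).totalDegree ≤ p.totalDegree * n := by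
  rw [MvPolynomial.aeval_def, MvPolynomial.eval₂_eq]
  refine (MvPolynomial.totalDegree_finsetSum _ _).trans (Finset.sup_le fun s hs => ?_)
  calc _ ≤ 0 + (∏ i ∈ s.support, f i ^ s i).totalDegree := by
        grw [MvPolynomial.totalDegree_mul, MvPolynomial.algebraMap_eq, MvPolynomial.totalDegree_C]
    _ ≤ ∑ i ∈ s.support, (f i ^ s i).totalDegree := by
        grw [zero_add, MvPolynomial.totalDegree_finsetProd]
    _ ≤ ∑ i ∈ s.support, s i * n := Finset.sum_le_sum fun i _ =>
        (MvPolynomial.totalDegree_pow _ _).trans (Nat.mul_le_mul_left _ (hf i))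
    _ ≤ p.totalDegree * n := by
        rw [← Finset.sum_mul]
        exact Nat.mul_le_mul_right _ (MvPolynomial.le_totalDegree hs)

theorem comp_rescale_mem_polyField (hv : v ∈ polyField d k) (hh : h ≠ 0) :
    v ∘ rescale x₀ hh ∈ polyField d k := by
  intro i
  obtain ⟨p, hp, hpv⟩ := hv i
  let f (j : Fin d) : MvPolynomial (Fin d) ℝ :=
    MvPolynomial.C (x₀ j) + MvPolynomial.C h * MvPolynomial.X j
  have hf (j) : (f j).totalDegree ≤ 1 := (MvPolynomial.totalDegree_add _ _).trans <|
    max_le (by simp) ((MvPolynomial.totalDegree_mul _ _).trans (by simp))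
  refine ⟨MvPolynomial.aeval f p, ?_, fun x => ?_⟩
  · simpa using (totalDegree_aeval_le hf p).trans (Nat.mul_le_mul_right 1 hp)
  · rw [Function.comp_apply, hpv, ← MvPolynomial.coe_aeval_eq_eval,
      ← MvPolynomial.coe_aeval_eq_eval, RingHom.coe_coe, RingHom.coe_coe,
      MvPolynomial.comp_aeval_apply]
    simp [f, rescale_apply]

theorem comp_rescale_symm_mem_rigidMotion (hr : r ∈ rigidMotion d) (hh : h ≠ 0) :
    r ∘ (rescale x₀ hh).symm ∈ rigidMotion d := by
  obtain ⟨a, η, hη, hr⟩ := hr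
  refine ⟨WithLp.toLp 2 fun i => a i - ∑ j, η i j * (h⁻¹ * x₀ j), h⁻¹ • η, ?_, fun x i => ?_⟩
  · rw [Matrix.transpose_smul, hη, smul_neg]
  · have hη' (j : Fin d) : h⁻¹ * η i j * x j = η i j * (h⁻¹ * x j) := by ring
    rw [Function.comp_apply, hr, rescale_symm_apply]
    simp only [PiLp.smul_apply, PiLp.sub_apply, smul_eq_mul, Matrix.smul_apply, mul_sub,
      Finset.sum_sub_distrib, hη']
    ring

theorem strain_comp_rescale (hv : Differentiable ℝ v) (hh : h ≠ 0) (z : E d) :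
    strain (v ∘ rescale x₀ hh) z = h • strain v (rescale x₀ hh z) := by
  have hφ : HasFDerivAt (rescale x₀ hh) (h • ContinuousLinearMap.id ℝ (E d)) z :=
    ((hasFDerivAt_id z).const_smul h).const_add x₀
  ext i j
  simp only [strain, ((hv _).hasFDerivAt.comp z hφ).fderiv, ContinuousLinearMap.comp_smul,
    ContinuousLinearMap.comp_id, smul_apply, PiLp.smul_apply, smul_eq_mul,
    Pi.smul_apply]
  ring

theorem strainNormSq_eq_mul_comp_rescale (hv : Differentiable ℝ v) (hh : 0 < h) (T : Set (E d)) :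
    h ^ 2 * strainNormSq v T =
      h ^ d * strainNormSq (v ∘ rescale x₀ hh.ne') (rescale x₀ hh.ne' ⁻¹' T) := by
  simp only [strainNormSq, strain_comp_rescale hv, Pi.smul_apply, smul_eq_mul, mul_pow,
    ← Finset.mul_sum, integral_const_mul]
  rw [← EuclideanSpace.euclideanHausdorffMeasure_eq_volume,
    setIntegral_euclideanHausdorffMeasure_eq_mul_rescale (x₀ := x₀) d hh T]
  ring

theorem HasPyramid.preimage_rescale {T e : Set (E d)} {σ θ : ℝ} (hT : HasPyramid T e σ θ)
    (hh : 0 < h) :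
    HasPyramid (rescale x₀ hh.ne' ⁻¹' T) (rescale x₀ hh.ne' ⁻¹' e) σ θ := by
  obtain ⟨A, n, s, hA, hn, hflat, hseg, hheight, hangle⟩ := hT
  obtain ⟨A, rfl⟩ := (rescale x₀ hh.ne').surjective A
  refine ⟨A, n, (s - inner ℝ n x₀) / h, hA, hn, fun z hz => ?_, iUnion₂_subset fun z hz w hw => ?_,
    ?_, fun z hz => ?_⟩
  · have hz := hflat _ hz
    rw [rescale_apply, inner_add_right, inner_smul_right] at hz
    rw [eq_div_iff hh.ne']
    linarith
  · exact hseg (mem_iUnion₂.2 ⟨_, hz, rescale_mem_segment hh.ne' hw⟩)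
  · rw [rescale_apply, inner_add_right, inner_smul_right] at hheight
    rw [diam_preimage_rescale hh, ← mul_div_assoc, div_le_iff₀ hh, sub_mul,
      div_mul_cancel₀ _ hh.ne']
    linarith
  · have hz := hangle _ hz
    rwa [rescale_apply, rescale_apply, add_sub_add_left_eq_sub, ← smul_sub,
      InnerProductGeometry.angle_smul_left_of_pos _ _ hh] at hz

end RescaleField

/-! ### Shape regular elements -/

/-- A compact set `T` whose boundary contains the flat sides `F`, with the shape regularity of
`PolytopalPartition.ShapeRegular` for this one element. The sides are measured against the diameter
of `T` directly, so that `c` plays the role of `ρe * κ ^ (d - 1)`. -/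
structure IsShapeRegularElement {d : ℕ} (T : Set (E d)) (F : Finset (Set (E d))) (ρ c σ : ℝ)
    (N : ℕ) : Prop where
  isCompact : IsCompact T
  nontrivial : T.Nontrivial
  volume_ge : ρ * Metric.diam T ^ d ≤ volume.real T
  measurableSet : ∀ e ∈ F, MeasurableSet e
  subset_frontier : ∀ e ∈ F, e ⊆ frontier T
  area_ge : ∀ e ∈ F, c * Metric.diam T ^ (d - 1) ≤ (μHE[d - 1]).real e
  pyramid : ∀ e ∈ F, ∃ θ, HasPyramid T e σ θ
  overlap : ∀ e ∈ F, ∀ e' ∈ F, e ≠ e' → μHE[d - 1] (e ∩ e') = 0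
  nonconvex_sides : {e | e ∈ F ∧ ¬ Convex ℝ e}.ncard ≤ N

namespace IsShapeRegularElement

variable {d : ℕ} {T e : Set (E d)} {F : Finset (Set (E d))} {ρ c σ : ℝ} {N : ℕ}

theorem diam_pos (hT : IsShapeRegularElement T F ρ c σ N) : 0 < Metric.diam T :=
  Metric.diam_pos hT.nontrivial hT.isCompact.isBounded

theorem side_subset (hT : IsShapeRegularElement T F ρ c σ N) (he : e ∈ F) : e ⊆ T :=
  (hT.subset_frontier e he).trans hT.isCompact.isClosed.frontier_subset

theorem isBounded_side (hT : IsShapeRegularElement T F ρ c σ N) (he : e ∈ F) :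
    Bornology.IsBounded e :=
  hT.isCompact.isBounded.subset (hT.side_subset he)

theorem measure_side_le (hT : IsShapeRegularElement T F ρ c σ N) (he : e ∈ F) :
    μHE[d - 1] e ≤ volume (Metric.closedBall (0 : E (d - 1)) (Metric.diam T)) := by
  obtain ⟨-, -, n, s, -, hn, hflat, -⟩ := hT.pyramid e he
  grw [euclideanHausdorffMeasure_le_of_flat (norm_pos_iff.1 (hn ▸ one_pos)) hflat
    (hT.isBounded_side he), Metric.diam_mono (hT.side_subset he) hT.isCompact.isBounded]

theorem measure_side_lt_top (hT : IsShapeRegularElement T F ρ c σ N) (he : e ∈ F) :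
    μHE[d - 1] e < ⊤ :=
  (hT.measure_side_le he).trans_lt measure_closedBall_lt_top

theorem preimage_rescale (hT : IsShapeRegularElement T F ρ c σ N) (x₀ : E d) {h : ℝ}
    (hh : 0 < h) :
    IsShapeRegularElement (rescale x₀ hh.ne' ⁻¹' T)
      (F.map ⟨preimage (rescale x₀ hh.ne'), (rescale x₀ hh.ne').surjective.preimage_injective⟩)
      ρ c σ N where
  isCompact := (rescale x₀ hh.ne').isCompact_preimage.2 hT.isCompact
  nontrivial := hT.nontrivial.preimage (rescale x₀ hh.ne').surjective
  volume_ge := by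
    rw [← EuclideanSpace.euclideanHausdorffMeasure_eq_volume,
      euclideanHausdorffMeasure_real_preimage_rescale d hh, diam_preimage_rescale hh, div_pow,
      ← mul_div_assoc, EuclideanSpace.euclideanHausdorffMeasure_eq_volume]
    grw [hT.volume_ge]
  measurableSet := Finset.forall_mem_map.2 fun e he =>
    (rescale x₀ hh.ne').measurable (hT.measurableSet e he)
  subset_frontier := Finset.forall_mem_map.2 fun e he => by
    rw [← Homeomorph.preimage_frontier]
    exact preimage_mono (hT.subset_frontier e he)
  area_ge := Finset.forall_mem_map.2 fun e he => by
    rw [Function.Embedding.coeFn_mk, euclideanHausdorffMeasure_real_preimage_rescale (d - 1) hh,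
      diam_preimage_rescale hh, div_pow, ← mul_div_assoc]
    grw [hT.area_ge e he]
  pyramid := Finset.forall_mem_map.2 fun e he =>
    (hT.pyramid e he).imp fun θ hθ => hθ.preimage_rescale hh
  overlap := Finset.forall_mem_map.2 fun e he => Finset.forall_mem_map.2 fun e' he' hne => by
    have hzero := hT.overlap e he e' he' fun hee => hne (hee ▸ rfl)
    rw [euclideanHausdorffMeasure_eq_mul_preimage_rescale (x₀ := x₀) (d - 1) hh, mul_eq_zero]
      at hzero
    exact hzero.resolve_left (by simpa using pow_pos hh _)
  nonconvex_sides := by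
    have hfin : {e | e ∈ F ∧ ¬ Convex ℝ e}.Finite := F.finite_toSet.subset fun e he => he.1
    refine (ncard_le_ncard (t := preimage (rescale x₀ hh.ne') '' {e | e ∈ F ∧ ¬ Convex ℝ e}) ?_
      (hfin.image _)).trans ((ncard_image_le hfin).trans hT.nonconvex_sides)
    rintro e' ⟨he', hconv⟩
    obtain ⟨e, he, rfl⟩ := Finset.mem_map.1 he'
    exact ⟨e, ⟨he, mt (convex_preimage_rescale hh.ne').2 hconv⟩, rfl⟩

theorem preimage_rescale_subset_closedBall (hT : IsShapeRegularElement T F ρ c σ N) {x₀ : E d}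
    (hx₀ : x₀ ∈ T) : rescale x₀ hT.diam_pos.ne' ⁻¹' T ⊆ Metric.closedBall 0 1 := fun z hz => by
  have hdist := Metric.dist_le_diam_of_mem hT.isCompact.isBounded hz hx₀
  rw [rescale_apply, dist_self_add_left, norm_smul, Real.norm_of_nonneg hT.diam_pos.le] at hdist
  rw [mem_closedBall_zero_iff]
  exact le_of_mul_le_mul_left (hdist.trans_eq (mul_one _).symm) hT.diam_pos

end IsShapeRegularElement

theorem IsPolytope.nontrivial {d m : ℕ} {P : Set (E d)} (hm : m ≠ 0) (hP : IsPolytope m P) :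
    P.Nontrivial := by
  obtain ⟨-, ⟨S, hS, rfl⟩, hconn⟩ := hP
  obtain ⟨x, hx⟩ := hconn.nonempty
  obtain ⟨s, hs, -⟩ := mem_iUnion₂.1 (intrinsicInterior_subset hx)
  have hcard : 1 < s.card := by
    rw [(hS s hs).1]
    omega
  exact ((Finset.one_lt_card_iff_nontrivial.1 hcard).mono (subset_convexHull ℝ _)).mono
    (subset_biUnion_of_mem (u := fun s : Finset (E d) => convexHull ℝ (s : Set (E d))) hs)

theorem PolytopalPartition.ShapeRegular.isShapeRegularElement {d : ℕ} {Ω : Set (E d)}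
    {𝒯 : PolytopalPartition d Ω} {s : ShapeParams} (h𝒯 : 𝒯.ShapeRegular s) (hd : d ≠ 0)
    {T : Set (E d)} (hT : T ∈ 𝒯.elements) :
    IsShapeRegularElement T (𝒯.sides T) s.ρv (s.ρe * s.κ ^ (d - 1)) s.σ s.N where
  isCompact := (𝒯.isPolytope T hT).isCompact
  nontrivial := (𝒯.isPolytope T hT).nontrivial hd
  volume_ge := h𝒯.volume_ge T hT
  measurableSet e he := (𝒯.isPolytope_side T hT e he).isCompact.measurableSet
  subset_frontier e he := by
    rw [← 𝒯.boundary T hT]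
    exact subset_biUnion_of_mem (u := id) he
  area_ge e he := by
    have hρ := s.ρe_pos
    have hκ := s.κ_pos
    grw [mul_assoc, ← mul_pow, h𝒯.diam_side_ge T hT e he, h𝒯.area_ge T hT e he]
  pyramid e he := ⟨s.θ, h𝒯.pyramid T hT e he⟩
  overlap e he e' he' := 𝒯.sides_overlap T hT T hT e he e' he'
  nonconvex_sides := h𝒯.nonconvex_sides T hT

/-! ### Estimates on shape regular elements -/

theorem exists_forall_card_sides_le (d : ℕ) [NeZero d] {c σ : ℝ} (hc : 0 < c) (hσ : 0 < σ) :
    ∃ M : ℕ, ∀ {T : Set (E d)} {F : Finset (Set (E d))} {ρ : ℝ} {N : ℕ},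
      IsShapeRegularElement T F ρ c σ N → F.card ≤ M + N := by
  classical
  obtain ⟨M, hM⟩ := exists_forall_card_convex_sides_le d 1 (ENNReal.ofReal_pos.2 hc) hσ
  suffices hunit : ∀ {T : Set (E d)} {F : Finset (Set (E d))} {ρ : ℝ} {N : ℕ},
      IsShapeRegularElement T F ρ c σ N → Metric.diam T = 1 → T ⊆ Metric.closedBall 0 1 →
      F.card ≤ M + N by
    refine ⟨M, fun {T F ρ N} hT => ?_⟩
    obtain ⟨x₀, hx₀⟩ := hT.nontrivial.nonempty
    simpa only [Finset.card_map] using hunit (hT.preimage_rescale x₀ hT.diam_pos)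
      (by rw [diam_preimage_rescale hT.diam_pos, div_self hT.diam_pos.ne'])
      (hT.preimage_rescale_subset_closedBall hx₀)
  intro T F ρ N hT hdiam hball
  rw [← Finset.card_filter_add_card_filter_not (s := F) fun e => Convex ℝ e]
  have hF : ∀ e ∈ F.filter fun e => Convex ℝ e, e ∈ F := fun e he => Finset.mem_of_mem_filter e he
  refine add_le_add ?_ ?_
  · refine hM hball (by rw [hdiam, mul_one]) (fun e he => (Finset.mem_filter.1 he).2)
      (fun e he => hT.subset_frontier e (hF e he)) (fun e he => hT.pyramid e (hF e he))
      (fun e he => ENNReal.ofReal_le_of_le_toReal ?_)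
      fun e he e' he' => hT.overlap e (hF e he) e' (hF e' he')
    simpa only [hdiam, one_pow, mul_one, measureReal_def] using hT.area_ge e (hF e he)
  · rw [← ncard_coe_finset, Finset.coe_filter]
    exact hT.nonconvex_sides

theorem exists_rigidMotion_sum_setIntegral_le_of_diam_eq_one (d k : ℕ) [NeZero d] {ρ c σ : ℝ}
    (hρ : 0 < ρ) (hc : 0 < c) (hσ : 0 < σ) (N : ℕ) :
    ∃ C : ℝ, 0 ≤ C ∧ ∀ {T : Set (E d)} {F : Finset (Set (E d))},
      IsShapeRegularElement T F ρ c σ N → Metric.diam T = 1 → T ⊆ Metric.closedBall 0 1 →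
      ∀ v ∈ polyField d k, ∃ r ∈ rigidMotion d,
        ∑ e ∈ F, ∫ x in e, ‖v x - r x‖ ^ 2 ∂μHE[d - 1] ≤ C * strainNormSq v T := by
  obtain ⟨M, hM⟩ := exists_forall_card_sides_le d hc hσ
  obtain ⟨C, hC, hkorn⟩ := exists_rigidMotion_norm_sub_sq_le (P := polyField d k)
    (fun v hv => analyticOnNhd_of_mem_polyField hv) (isCompact_closedBall (0 : E d) 1) hρ
  set ω := volume.real (Metric.closedBall (0 : E (d - 1)) 1)
  refine ⟨(M + N) * (C * ω), by positivity, fun {T F} hT hdiam hball v hv => ?_⟩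
  obtain ⟨r, hr, hvr⟩ := hkorn v hv T hball hT.isCompact.measurableSet
    (by simpa only [hdiam, one_pow, mul_one] using hT.volume_ge)
  have hS := strainNormSq_nonneg v T
  have hside : ∀ e ∈ F, ∫ x in e, ‖v x - r x‖ ^ 2 ∂μHE[d - 1] ≤ C * strainNormSq v T * ω := by
    intro e he
    have harea : (μHE[d - 1]).real e ≤ ω := ENNReal.toReal_mono measure_closedBall_lt_top.ne
      (hdiam ▸ hT.measure_side_le he)
    grw [← harea]
    refine (le_abs_self _).trans <| norm_setIntegral_le_of_norm_le_const
      (f := fun x => ‖v x - r x‖ ^ 2) (hT.measure_side_lt_top he) fun x hx => ?_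
    rw [Real.norm_of_nonneg (sq_nonneg _)]
    exact hvr x (hball (hT.side_subset he hx))
  have hcard : (F.card : ℝ) ≤ M + N := mod_cast hM hT
  refine ⟨r, hr, ?_⟩
  calc ∑ e ∈ F, ∫ x in e, ‖v x - r x‖ ^ 2 ∂μHE[d - 1]
      ≤ F.card • (C * strainNormSq v T * ω) := Finset.sum_le_card_nsmul _ _ _ hside
    _ ≤ (M + N) * (C * strainNormSq v T * ω) := by
        rw [nsmul_eq_mul]
        grw [hcard]
    _ = (M + N) * (C * ω) * strainNormSq v T := by ring

theorem exists_rigidMotion_sum_setIntegral_le (d k : ℕ) [NeZero d] {ρ c σ : ℝ}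
    (hρ : 0 < ρ) (hc : 0 < c) (hσ : 0 < σ) (N : ℕ) :
    ∃ C : ℝ, 0 ≤ C ∧ ∀ {T : Set (E d)} {F : Finset (Set (E d))},
      IsShapeRegularElement T F ρ c σ N → ∀ v ∈ polyField d k, ∃ r ∈ rigidMotion d,
        ∑ e ∈ F, ∫ x in e, ‖v x - r x‖ ^ 2 ∂μHE[d - 1] ≤
          C * Metric.diam T * strainNormSq v T := by
  obtain ⟨C, hC, hunit⟩ := exists_rigidMotion_sum_setIntegral_le_of_diam_eq_one d k hρ hc hσ N
  refine ⟨C, hC, fun {T F} hT v hv => ?_⟩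
  obtain ⟨x₀, hx₀⟩ := hT.nontrivial.nonempty
  have hpos := hT.diam_pos
  set h := Metric.diam T
  let φ := rescale x₀ hpos.ne'
  obtain ⟨r, hr, hle⟩ := hunit (hT.preimage_rescale x₀ hpos)
    (by rw [diam_preimage_rescale hpos, div_self hpos.ne'])
    (hT.preimage_rescale_subset_closedBall hx₀) (v ∘ φ) (comp_rescale_mem_polyField hv _)
  refine ⟨r ∘ φ.symm, comp_rescale_symm_mem_rigidMotion hr _, ?_⟩
  have hside (e : Set (E d)) : ∫ x in e, ‖v x - (r ∘ φ.symm) x‖ ^ 2 ∂μHE[d - 1] =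
      h ^ (d - 1) * ∫ z in φ ⁻¹' e, ‖(v ∘ φ) z - r z‖ ^ 2 ∂μHE[d - 1] := by
    rw [setIntegral_euclideanHausdorffMeasure_eq_mul_rescale (x₀ := x₀) (d - 1) hpos]
    simp only [Function.comp_apply, φ, Homeomorph.symm_apply_apply]
  calc ∑ e ∈ F, ∫ x in e, ‖v x - (r ∘ φ.symm) x‖ ^ 2 ∂μHE[d - 1]
      = h ^ (d - 1) * ∑ e ∈ F, ∫ z in φ ⁻¹' e, ‖(v ∘ φ) z - r z‖ ^ 2 ∂μHE[d - 1] := by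
        simp only [hside, Finset.mul_sum]
    _ ≤ h ^ (d - 1) * (C * strainNormSq (v ∘ φ) (φ ⁻¹' T)) := by
        gcongr
        exact (Finset.sum_map _ _ _).symm.trans_le hle
    _ = C * h * strainNormSq v T := by
        have hscale := strainNormSq_eq_mul_comp_rescale (x₀ := x₀)
          (differentiable_of_mem_polyField hv) hpos T
        refine mul_left_cancel₀ hpos.ne' ?_
        rw [← mul_assoc, mul_pow_sub_one (NeZero.ne d)]
        linear_combination -C * hscale

/-! ### Best approximation -/

section BestApproximation

variable {d k : ℕ} {e : Set (E d)} {v r : E d → E d}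

theorem Lp_norm_sq_eq_integral {X V : Type*} [MeasurableSpace X] [NormedAddCommGroup V]
    [InnerProductSpace ℝ V] {μ : Measure X} (f : Lp V 2 μ) : ‖f‖ ^ 2 = ∫ x, ‖f x‖ ^ 2 ∂μ := by
  rw [← real_inner_self_eq_norm_sq, L2.inner_def]
  simp_rw [real_inner_self_eq_norm_sq]

theorem norm_sq_toLp_sub_eq_integral {X V : Type*} [MeasurableSpace X] [NormedAddCommGroup V]
    [InnerProductSpace ℝ V] {μ : Measure X} {v w : X → V} (hv : MemLp v 2 μ) {f : Lp V 2 μ}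
    (hw : f =ᵐ[μ] w) : ‖hv.toLp v - f‖ ^ 2 = ∫ x, ‖v x - w x‖ ^ 2 ∂μ := by
  rw [Lp_norm_sq_eq_integral]
  refine integral_congr_ae ?_
  filter_upwards [Lp.coeFn_sub (hv.toLp v) f, hv.coeFn_toLp, hw] with x hsub hvx hwx
  rw [hsub, Pi.sub_apply, hvx, hwx]

theorem sideErrorSq_le (hv : MemLp v 2 (sideMeasure e)) (hr : r ∈ sideField d k)
    (hrL : MemLp r 2 (sideMeasure e)) :
    sideErrorSq k v e ≤ ∫ x, ‖v x - r x‖ ^ 2 ∂sideMeasure e := by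
  have hmem : hrL.toLp r ∈ sideSpace k e := ⟨r, hr, hrL.coeFn_toLp⟩
  rw [sideErrorSq, Qb, dif_pos hv, ← norm_sq_toLp_sub_eq_integral hv hrL.coeFn_toLp,
    ← norm_sq_toLp_sub_eq_integral hv (ae_eq_refl _), Submodule.starProjection_minimal]
  refine pow_le_pow_left₀ (Real.iInf_nonneg fun w => norm_nonneg _) ?_ 2
  exact ciInf_le (f := fun w : sideSpace k e => ‖hv.toLp v - w‖)
    ⟨0, forall_mem_range.2 fun w => norm_nonneg _⟩ ⟨_, hmem⟩

theorem memLp_sideMeasure (hb : Bornology.IsBounded e) (he : MeasurableSet e)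
    (hμ : μHE[d - 1] e < ⊤) (hv : Continuous v) (p : ENNReal) : MemLp v p (sideMeasure e) := by
  have : IsFiniteMeasure (sideMeasure e) := ⟨by rwa [sideMeasure, Measure.restrict_apply_univ]⟩
  obtain ⟨C, hC⟩ := hb.isCompact_closure.exists_bound_of_continuousOn hv.continuousOn
  exact MemLp.of_bound hv.aestronglyMeasurable C <|
    (ae_restrict_iff' he).2 (.of_forall fun x hx => hC x (subset_closure hx))

end BestApproximation

end WG

open WG in
theorem mainTheorem7_general (d k : ℕ) [NeZero d] {ρ c σ : ℝ} (hρ : 0 < ρ) (hc : 0 < c)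
    (hσ : 0 < σ) (N : ℕ) :
    ∃ C : ℝ, 0 < C ∧ ∀ (T : Set (E d)) (F : Finset (Set (E d))),
      IsShapeRegularElement T F ρ c σ N → ∀ v ∈ polyField d k,
        ∑ e ∈ F, sideErrorSq k v e ≤ C * Metric.diam T * strainNormSq v T := by
  obtain ⟨C, hC, happrox⟩ := exists_rigidMotion_sum_setIntegral_le d k hρ hc hσ N
  refine ⟨C + 1, by positivity, fun T F hT v hv => ?_⟩
  obtain ⟨r, hr, hle⟩ := happrox hT v hv
  have hproj : ∀ e ∈ F, sideErrorSq k v e ≤ ∫ x in e, ‖v x - r x‖ ^ 2 ∂μHE[d - 1] := by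
    intro e he
    have hmem {w : E d → E d} (hw : Continuous w) : MemLp w 2 (sideMeasure e) :=
      memLp_sideMeasure (hT.isBounded_side he) (hT.measurableSet e he) (hT.measure_side_lt_top he)
        hw 2
    exact sideErrorSq_le (hmem (polyField_continuous hv)) (Submodule.mem_sup_right hr)
      (hmem (polyField_continuous (rigidMotion_le d hr)))
  have hS := strainNormSq_nonneg v T
  grw [Finset.sum_le_sum hproj, hle, ← le_add_of_nonneg_right zero_le_one]

theorem mainTheorem7 (d : ℕ) (hd : 2 ≤ d) (k : ℕ) (hk : 1 ≤ k) (s : WG.ShapeParams) :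
    ∃ C : ℝ, 0 < C ∧
      ∀ (Ω : Set (WG.E d)), IsOpen Ω → Bornology.IsBounded Ω → IsConnected Ω →
      ∀ 𝒯 : WG.PolytopalPartition d Ω, 𝒯.ShapeRegular s →
      ∀ T ∈ 𝒯.elements, ∀ v₀ ∈ WG.polyField d k,
        𝒯.boundaryErrorSq k v₀ T ≤ C * Metric.diam T * WG.strainNormSq v₀ T := by
  have : NeZero d := ⟨by omega⟩
  obtain ⟨C, hC, hbound⟩ := mainTheorem7_general d k s.ρv_pos
    (mul_pos s.ρe_pos (pow_pos s.κ_pos (d - 1))) s.σ_pos s.N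
  exact ⟨C, hC, fun Ω _ _ _ 𝒯 h𝒯 T hT =>
    hbound T _ (h𝒯.isShapeRegularElement (NeZero.ne d) hT)⟩
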